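/- \textbf{Setting.} Let $N\ge 1$, $E=\mathbb R^N$ with the Euclidean norm, $\gamma_0>0$; for every $\gamma\in(0,\gamma_0)$ let $P_\gamma$ be a probability transition kernel on $E$, and let $(\Xi,\mathcal G,\mu)$ be a probability space. For a point $y$ and a set $S$ put $d(y,S)=\inf_{z\in S}\|y-z\|$, with $\inf\emptyset=+\infty$. The space $C(\mathbb R_+,E)$ carries the topology of uniform convergence on compact sets. For a set-valued map $\mathsf H:E\rightrightarrows E$ and $a\in E$, let $\Phi_{\mathsf H}(a)$ be the set of functions $\mathsf x:\mathbb R_+\to E$, absolutely continuous on every compact interval, such that $\mathsf x(0)=a$ and $\dot{\mathsf x}(t)\in\mathsf H(\mathsf x(t))$ for almost every $t\ge 0$. Put $\Phi_{\mathsf H}(E)=\bigcup_{a\in E}\Phi_{\mathsf H}(a)\subset C(\mathbb R_+,E)$. The Birkhoff center of $\Phi=\Phi_{\mathsf H}$ is $$\mathrm{BC}_\Phi=\overline{\Big\{a\in E:\ a\in\bigcup_{\mathsf x\in\Phi(a)}L_{\mathsf x}\Big\}},\qquad L_{\mathsf x}=\bigcap_{t\ge0}\overline{\mathsf x([t,+\infty))}.$$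 For $G:\Xi\rightrightarrows E$, the selection integral $\int G\,d\mu$ is the closure of the set of all $\int\varphi\,d\mu$, where $\varphi:\Xi\to E$ is $\mu$-integrable and $\varphi(s)\in G(s)$ for $\mu$-a.e. $s$; $G$ is called $\mu$-integrable if at least one such $\varphi$ exists. \textbf{(RM)} There are maps $h_\gamma:\Xi\times E\to E$, $\gamma\in(0,\gamma_0)$, each jointly measurable, and $H:\Xi\times E\rightrightarrows E$ such that: (i) $\int\frac{y-x}{\gamma}P_\gamma(x,dy)=\int h_\gamma(s,x)\,\mu(ds)$ for all $x\in E$ and $\gamma\in(0,\gamma_0)$; (ii) for $\mu$-a.e. $s$ and every sequence $(u_n,\gamma_n)$ in $E\times(0,\gamma_0)$ converging to some $(u^\star,0)$, $d(h_{\gamma_n}(s,u_n),H(s,u^\star))\to0$; (iii) for $\mu$-a.e. $s$, $H(s,\cdot)$ is not identically empty, is upper semicontinuous (for every $a_0$ and every open $U\supset H(s,a_0)$, $H(s,a)\subset U$ for all $a$ near $a_0$), and has closed convex values; (iv) for every $x$, $H(\cdot,x)$ is $\mu$-integrable; set $\mathsf H(x)=\int H(s,x)\,\mu(ds)$; (v)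 $\Phi_{\mathsf H}(a)\neq\emptyset$ for every $a\in E$, and for all $T>0$ and compact $K\subset E$, $\sup\{\|\mathsf x(t)\|:t\in[0,T],\ \mathsf x\in\Phi_{\mathsf H}(a),\ a\in K\}<\infty$; (vi) for every compact $K\subset E$ there is $\epsilon_K>0$ such that $$\sup_{x\in K}\sup_{0<\gamma<\gamma_0}\int\Big\|\frac{y-x}\gamma\Big\|^{1+\epsilon_K}P_\gamma(x,dy)<\infty,\qquad \sup_{x\in K}\sup_{0<\gamma<\gamma_0}\int\|h_\gamma(s,x)\|^{1+\epsilon_K}\mu(ds)<\infty.$$ \textbf{(PH)} There are measurable $V,\psi:E\to[0,+\infty)$ and functions $\alpha:(0,\gamma_0)\to(0,+\infty)$, $\beta:(0,\gamma_0)\to\mathbb R$ such that $\sup_\gamma\beta(\gamma)/\alpha(\gamma)<\infty$, $\psi(x)\to+\infty$ as $\|x\|\to+\infty$, and $P_\gamma V\le V-\alpha(\gamma)\psi+\beta(\gamma)$ pointwise for every $\gamma\in(0,\gamma_0)$. \textbf{(FL)} For every $s\in\Xi$ and $\gamma\in(0,\gamma_0)$, the function $h_\gamma(s,\cdot)$ is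 continuous. \textbf{Theorem.} Assume (RM), (PH), (FL), and that $\Phi_{\mathsf H}(E)$ is closed in $C(\mathbb R_+,E)$. Let $\nu$ be a probability measure on $E$ with $\int V\,d\nu<\infty$, with $V$ as in (PH). Let $\mathbb P^{\nu,\gamma}$ be the law on $E^{\mathbb N}$ under which the coordinate process $(X_k)_{k\in\mathbb N}$ is a homogeneous Markov chain with initial distribution $\nu$ and transition kernel $P_\gamma$. Then for every $\varepsilon>0$, $$\lim_{\gamma\to0}\ \limsup_{n\to\infty}\ \frac1{n+1}\sum_{k=0}^n\mathbb P^{\nu,\gamma}\big(d(X_k,\mathrm{BC}_{\Phi_{\mathsf H}})\ge\varepsilon\big)=0.$$ -/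

import Mathlib

open MeasureTheory ProbabilityTheory Filter Topology Set
open scoped NNReal ENNReal

noncomputable section

namespace SADI

/-! ### Differential inclusions, limit sets, Birkhoff center -/

/-- `x` solves the differential inclusion `x'(t) ∈ F (x t)` on `[0, ∞)` with initial condition `a`:
`x 0 = a`, `x` is absolutely continuous on every compact interval `[0, T]`, and for almost every
`t > 0` the derivative `x'(t)` exists and belongs to `F (x t)`. -/
def IsSolution {E : Type*} [NormedAddCommGroup E] [NormedSpace ℝ E]
    (F : E → Set E) (a : E) (x : C(ℝ≥0, E)) : Prop :=
  x 0 = a ∧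
  (∀ T : ℝ, 0 < T → AbsolutelyContinuousOnInterval (fun t : ℝ => x t.toNNReal) 0 T) ∧
  ∀ᵐ t : ℝ ∂(volume.restrict (Ioi (0 : ℝ))),
    ∃ v ∈ F (x t.toNNReal), HasDerivAt (fun s : ℝ => x s.toNNReal) v t

/-- The evolution system `Φ_F : E ⇉ C(ℝ₊, E)` induced by the set-valued map `F`. The space
`C(ℝ₊, E)` carries Mathlib's compact-open topology, i.e. uniform convergence on compact sets. -/
def evolution {E : Type*} [NormedAddCommGroup E] [NormedSpace ℝ E]
    (F : E → Set E) (a : E) : Set C(ℝ≥0, E) :=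
  {x | IsSolution F a x}

/-- The range `Φ(E) = ⋃ₐ Φ(a)` of a set-valued evolution system. -/
def evolutionRange {E : Type*} [TopologicalSpace E] (Φ : E → Set C(ℝ≥0, E)) : Set C(ℝ≥0, E) :=
  ⋃ a, Φ a

/-- The limit set `L_x = ⋂_{t ≥ 0} closure (x([t, ∞)))` of a trajectory. -/
def limitSet {E : Type*} [TopologicalSpace E] (x : C(ℝ≥0, E)) : Set E :=
  ⋂ t : ℝ≥0, closure (x '' Ici t)

/-- The limit set `L_{Φ(a)} = ⋃_{x ∈ Φ(a)} L_x` of a point. -/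
def limitSetAt {E : Type*} [TopologicalSpace E] (Φ : E → Set C(ℝ≥0, E)) (a : E) : Set E :=
  ⋃ x ∈ Φ a, limitSet x

/-- The Birkhoff center of `Φ`: the closure of the set of recurrent points. -/
def birkhoffCenter {E : Type*} [TopologicalSpace E] (Φ : E → Set C(ℝ≥0, E)) : Set E :=
  closure {a | a ∈ limitSetAt Φ a}

/-! ### Selection integral -/

/-- The integrable selections of the set-valued map `G`. -/
def selections {Ξ E : Type*} [MeasurableSpace Ξ] [NormedAddCommGroup E]
    (μ : Measure Ξ) (G : Ξ → Set E) : Set (Ξ → E) :=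
  {φ | Integrable φ μ ∧ ∀ᵐ s ∂μ, φ s ∈ G s}

/-- The selection integral: closure of the set of integrals of integrable selections. -/
def selectionIntegral {Ξ E : Type*} [MeasurableSpace Ξ] [NormedAddCommGroup E] [NormedSpace ℝ E]
    (μ : Measure Ξ) (G : Ξ → Set E) : Set E :=
  closure ((fun φ : Ξ → E => ∫ s, φ s ∂μ) '' selections μ G)

/-- The mean set-valued map `x ↦ ∫ H(s, x) μ(ds)`. -/
def meanMap {Ξ E : Type*} [MeasurableSpace Ξ] [NormedAddCommGroup E] [NormedSpace ℝ E]
    (μ : Measure Ξ) (H : Ξ → E → Set E) (x : E) : Set E :=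
  selectionIntegral μ (fun s => H s x)

/-! ### Homogeneous Markov chains on the canonical space -/

/-- The law on `ℕ → E` of the homogeneous Markov chain with initial distribution `ν` and
transition kernel `P` (Ionescu-Tulcea). -/
def chainLaw {E : Type*} [MeasurableSpace E] (ν : Measure E) (P : Kernel E E) [IsMarkovKernel P] :
    Measure (ℕ → E) :=
  Kernel.trajMeasure (X := fun _ => E) ν
    (fun n => P.comap (fun w : (Π _ : Finset.Iic n, E) => w ⟨n, Finset.mem_Iic.2 le_rfl⟩)
      (measurable_pi_apply _))

/-! ### The assumptions -/

/-- Assumption (RM) on the transition kernels `P γ`, `γ ∈ (0, γ₀)`, for the maps `h γ` and the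
set-valued map `H`. -/
structure RM {Ξ E : Type*} [MeasurableSpace Ξ] [NormedAddCommGroup E] [NormedSpace ℝ E]
    [MeasurableSpace E] {γ₀ : ℝ} (P : Ioo (0 : ℝ) γ₀ → Kernel E E) (μ : Measure Ξ)
    (h : Ioo (0 : ℝ) γ₀ → Ξ → E → E) (H : Ξ → E → Set E) : Prop where
  measurable : ∀ γ, Measurable (fun p : Ξ × E => h γ p.1 p.2)
  /-- Both integrals converge absolutely, by the moment bounds below. -/
  drift : ∀ γ x, ∫ y, (γ : ℝ)⁻¹ • (y - x) ∂(P γ x) = ∫ s, h γ s x ∂μ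
  /-- The distance to a set is the extended one: the distance to the empty set is infinite. -/
  tendsto : ∀ᵐ s ∂μ, ∀ (u : ℕ → E) (γ : ℕ → Ioo (0 : ℝ) γ₀) (u' : E),
    Tendsto u atTop (𝓝 u') → Tendsto (fun n => (γ n : ℝ)) atTop (𝓝 0) →
    Tendsto (fun n => Metric.infEDist (h (γ n) s (u n)) (H s u')) atTop (𝓝 0)
  usc : ∀ᵐ s ∂μ, (∃ x, (H s x).Nonempty) ∧ UpperHemicontinuous (H s) ∧
    ∀ x, IsClosed (H s x) ∧ Convex ℝ (H s x)
  integrable : ∀ x, (selections μ (fun s => H s x)).Nonempty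
  /-- Every initial point has at least one solution on `[0, ∞)`. -/
  exists_solution : ∀ a, (evolution (meanMap μ H) a).Nonempty
  bounded : ∀ T : ℝ≥0, 0 < T → ∀ K : Set E, IsCompact K →
    ∃ C : ℝ, ∀ a ∈ K, ∀ x ∈ evolution (meanMap μ H) a, ∀ t ≤ T, ‖x t‖ ≤ C
  moment : ∀ K : Set E, IsCompact K → ∃ ε : ℝ, 0 < ε ∧ ∃ C : ℝ≥0, ∀ x ∈ K, ∀ γ,
    ∫⁻ y, ‖(γ : ℝ)⁻¹ • (y - x)‖ₑ ^ (1 + ε) ∂(P γ x) ≤ C ∧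
    ∫⁻ s, ‖h γ s x‖ₑ ^ (1 + ε) ∂μ ≤ C

/-- Assumption (PH), the Pakes-Has'minskii criterion, for the functions `V`, `ψ`, `α`, `β`. -/
structure PH {E : Type*} [NormedAddCommGroup E] [MeasurableSpace E] {γ₀ : ℝ}
    (P : Ioo (0 : ℝ) γ₀ → Kernel E E) (V ψ : E → ℝ) (α β : Ioo (0 : ℝ) γ₀ → ℝ) : Prop where
  measurable_V : Measurable V
  measurable_psi : Measurable ψ
  V_nonneg : ∀ x, 0 ≤ V x
  psi_nonneg : ∀ x, 0 ≤ ψ x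
  alpha_pos : ∀ γ, 0 < α γ
  ratio_bounded : ∃ C : ℝ, ∀ γ, β γ / α γ ≤ C
  psi_tendsto : Tendsto ψ (Bornology.cobounded E) atTop
  /-- `P_γ V ≤ V - α(γ) ψ + β(γ)` pointwise; in particular `P_γ V` is finite everywhere. -/
  drift : ∀ γ x, Integrable V (P γ x) ∧ ∫ y, V y ∂(P γ x) ≤ V x - α γ * ψ x + β γ

/-- Assumption (FL): every `h γ s` is continuous. -/
def FL {Ξ E : Type*} [TopologicalSpace E] {γ₀ : ℝ} (h : Ioo (0 : ℝ) γ₀ → Ξ → E → E) : Prop :=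
  ∀ s γ, Continuous (h γ s)

end SADI

end

open MeasureTheory ProbabilityTheory Filter Topology Set
open scoped NNReal ENNReal

/-! The proof counts returns along single paths and then uses compactness; no invariant measure
appears.

By the drift condition, the chain spends all but a small proportion of its time in a compact set `K`
(`sum_measure_notMem_le`). For each scale `i`, cover `K` by finitely many balls of radius `r i / 2`.
Any sequence spends at most about a proportion `1 / (Q + 1)` of its time at visits to a given ball
that are not followed by another visit at one of the next `Q` multiples of a lag `s`, since the set
of these visits has disjoint translates by `0, s, …, Q s` (`card_visit_without_return_le`). Take
lags of rescaled length about `i + 1` and `Q i` large. Then, for most `k`, the path after time `k`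
comes back within `r i` of its position at time `k`, after a rescaled time between about `i + 1` and
`Q i * (i + 1)`, for all `i ≤ J` at once.

Over a bounded rescaled horizon, the accumulated deviation from the mean field tends to `0` in
probability, uniformly in the starting time (`exists_measure_not_noiseSmall_le`), and limits of
paths with vanishing deviation solve the inclusion (`exists_subseq_tendsto_path`). Suppose that such
returning paths started far from the Birkhoff center for arbitrarily large `J`. A limit would be a
solution `x` that, for every `i`, comes back within `r i` of `x 0` after time at least `i + 1`. Then
`x 0` lies in its own limit set, a contradiction (`exists_infEDist_birkhoffCenter_lt`). The `Q i`
are fixed before `J`, so the returns survive in the limit.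

Limits are identified on the product of time and `Ξ`, where the velocities are bounded in `L^p` for
some `p > 1`. Convex combinations of tails converge almost everywhere (`exists_convexHull_tendsto`),
and the closed convex values of `H s` retain the limit (`ae_hasDerivAt_of_tendsto`). The noise has
only `1 + ε` moments, so its increments are truncated: the bounded part is a martingale, the rest is
small in `L^1`. -/

namespace SADI

/-! ### Convergent convex combinations of sequences bounded in `L^p`, `p > 1` -/

section ConvexCombinations

variable {E : Type*} [NormedAddCommGroup E] [InnerProductSpace ℝ E]

/-- Quantitative strict convexity of `v ↦ √(1 + ‖v‖²)`. -/
lemma sq_norm_sub_le_bracket (a b : E) :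
    √(1 + ‖(1 / 2 : ℝ) • (a + b)‖ ^ 2) ≤ (√(1 + ‖a‖ ^ 2) + √(1 + ‖b‖ ^ 2)) / 2 ∧
    ‖a - b‖ ^ 2 ≤ 4 * (√(1 + ‖a‖ ^ 2) * √(1 + ‖b‖ ^ 2)) * (√(1 + ‖a‖ ^ 2) + √(1 + ‖b‖ ^ 2)) *
      ((√(1 + ‖a‖ ^ 2) + √(1 + ‖b‖ ^ 2)) / 2 - √(1 + ‖(1 / 2 : ℝ) • (a + b)‖ ^ 2)) := by
  have hA2 : √(1 + ‖a‖ ^ 2) ^ 2 = 1 + ‖a‖ ^ 2 := Real.sq_sqrt (by positivity)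
  have hB2 : √(1 + ‖b‖ ^ 2) ^ 2 = 1 + ‖b‖ ^ 2 := Real.sq_sqrt (by positivity)
  have hM2 : √(1 + ‖(1 / 2 : ℝ) • (a + b)‖ ^ 2) ^ 2 = 1 + ‖(1 / 2 : ℝ) • (a + b)‖ ^ 2 :=
    Real.sq_sqrt (by positivity)
  have hA1 : 0 < √(1 + ‖a‖ ^ 2) := by positivity
  have hB1 : 0 < √(1 + ‖b‖ ^ 2) := by positivity
  have hM1 : 0 < √(1 + ‖(1 / 2 : ℝ) • (a + b)‖ ^ 2) := by positivity
  set A := √(1 + ‖a‖ ^ 2)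
  set B := √(1 + ‖b‖ ^ 2)
  set M := √(1 + ‖(1 / 2 : ℝ) • (a + b)‖ ^ 2)
  have hm : ‖(1 / 2 : ℝ) • (a + b)‖ ^ 2 = (‖a‖ ^ 2 + 2 * inner ℝ a b + ‖b‖ ^ 2) / 4 := by
    rw [norm_smul, mul_pow, norm_add_sq_real]; norm_num; ring
  have hs : ‖a - b‖ ^ 2 = ‖a‖ ^ 2 - 2 * inner ℝ a b + ‖b‖ ^ 2 := norm_sub_sq_real a b
  have hcs : (inner ℝ a b) ^ 2 ≤ ‖a‖ ^ 2 * ‖b‖ ^ 2 := by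
    rw [← mul_pow, ← sq_abs]
    exact pow_le_pow_left₀ (abs_nonneg _) (abs_real_inner_le_norm a b) 2
  set i := inner ℝ a b
  -- The right side is the Gram determinant of `(1, a)` and `(1, b)`; it equals `‖a - b‖ ^ 2` plus
  -- the Gram determinant of `a` and `b`, which is nonnegative.
  have h1 : ‖a - b‖ ^ 2 ≤ (A * B) ^ 2 - (1 + i) ^ 2 := by
    rw [mul_pow, hA2, hB2, hs]; nlinarith
  have hAB : 0 < A * B := by positivity
  have hle : 1 + i ≤ A * B := by
    have : (1 + i) ^ 2 ≤ (A * B) ^ 2 := by nlinarith [sq_nonneg ‖a - b‖]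
    exact le_trans (le_abs_self _) (abs_le_of_sq_le_sq this hAB.le)
  have hD : ((A + B) / 2 - M) * ((A + B) / 2 + M) = (A * B - (1 + i)) / 2 := by
    nlinarith
  have hMle : M ≤ (A + B) / 2 := by
    by_contra! hc
    nlinarith
  refine ⟨hMle, ?_⟩
  have h2 : (A * B - (1 + i)) / 2 ≤ ((A + B) / 2 - M) * (A + B) := by
    rw [← hD]
    exact mul_le_mul_of_nonneg_left (by linarith) (by linarith)
  calc ‖a - b‖ ^ 2 ≤ (A * B - (1 + i)) * (A * B + (1 + i)) := by linarith
    _ ≤ (A * B - (1 + i)) * (2 * (A * B)) :=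
        mul_le_mul_of_nonneg_left (by linarith) (by linarith)
    _ ≤ (2 * (((A + B) / 2 - M) * (A + B))) * (2 * (A * B)) :=
        mul_le_mul_of_nonneg_right (by linarith) (by positivity)
    _ = _ := by ring

/-- In a ball of radius `R`, either `‖a - b‖ ≤ η` or `‖a - b‖ ≤ ‖a - b‖ ^ 2 / η`, and the square is
controlled by the convexity gap. Outside it, `‖a - b‖` is at most twice the larger norm, which the
`p`-th power dominates. Integrated, this turns a small convexity gap into a small `L^1` distance. -/
lemma exists_norm_sub_le_bracket {p η : ℝ} (hp : 1 < p) (hη : 0 < η) :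
    ∃ C : ℝ, 0 ≤ C ∧ ∀ a b : E, ‖a - b‖ ≤ η +
      C * ((√(1 + ‖a‖ ^ 2) + √(1 + ‖b‖ ^ 2)) / 2 - √(1 + ‖(1 / 2 : ℝ) • (a + b)‖ ^ 2)) +
      η * (‖a‖ ^ p + ‖b‖ ^ p) := by
  obtain ⟨R, hR1, hR⟩ : ∃ R : ℝ, 1 ≤ R ∧ 2 * R ^ (-(p - 1)) ≤ η := by
    have h : Tendsto (fun R : ℝ => 2 * R ^ (-(p - 1))) atTop (𝓝 (2 * 0)) :=
      (tendsto_rpow_neg_atTop (by linarith)).const_mul 2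
    rw [mul_zero] at h
    exact ((eventually_ge_atTop 1).and (h.eventually_le_const hη)).exists
  have key : ∀ a b : E, ‖b‖ ≤ ‖a‖ → R < ‖a‖ → ‖a - b‖ ≤ η * ‖a‖ ^ p := by
    intro a b hab ha
    have ha0 : 0 < ‖a‖ := by linarith
    calc ‖a - b‖ ≤ ‖a‖ + ‖b‖ := norm_sub_le _ _
      _ ≤ 2 * ‖a‖ := by linarith
      _ = 2 * ‖a‖ ^ (-(p - 1)) * ‖a‖ ^ p := by
          rw [mul_assoc, ← Real.rpow_add ha0]; norm_num
      _ ≤ 2 * R ^ (-(p - 1)) * ‖a‖ ^ p := by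
          gcongr ?_ * ?_ * _
          exact Real.rpow_le_rpow_of_nonpos (by linarith) ha.le (by linarith)
      _ ≤ η * ‖a‖ ^ p := by gcongr
  -- Both brackets are at most `1 + R` in the ball, so the factor `4 A B (A + B)` is at most `8 (1 +
  -- R) ^ 3`.
  refine ⟨8 * (1 + R) ^ 3 / η, by positivity, fun a b => ?_⟩
  obtain ⟨hM, hsq⟩ := sq_norm_sub_le_bracket a b
  have hbr : ∀ v : E, ‖v‖ ≤ R → √(1 + ‖v‖ ^ 2) ≤ 1 + R := by
    intro v hv
    rw [Real.sqrt_le_left (by linarith)]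
    nlinarith [norm_nonneg v]
  set D := (√(1 + ‖a‖ ^ 2) + √(1 + ‖b‖ ^ 2)) / 2 - √(1 + ‖(1 / 2 : ℝ) • (a + b)‖ ^ 2)
  have hD : 0 ≤ D := by simp only [D]; linarith
  have hp1 : 0 ≤ η * ‖a‖ ^ p := by positivity
  have hp2 : 0 ≤ η * ‖b‖ ^ p := by positivity
  have hp3 : 0 ≤ 8 * (1 + R) ^ 3 / η * D := by positivity
  rw [mul_add]
  rcases le_or_gt ‖a‖ R with ha | ha
  · rcases le_or_gt ‖b‖ R with hb | hb
    · have h1 : ‖a - b‖ ^ 2 ≤ 8 * (1 + R) ^ 3 * D := by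
        refine hsq.trans (mul_le_mul_of_nonneg_right ?_ hD)
        calc 4 * (√(1 + ‖a‖ ^ 2) * √(1 + ‖b‖ ^ 2)) * (√(1 + ‖a‖ ^ 2) + √(1 + ‖b‖ ^ 2))
            ≤ 4 * ((1 + R) * (1 + R)) * ((1 + R) + (1 + R)) := by
              gcongr <;> apply hbr <;> assumption
          _ = _ := by ring
      rcases le_or_gt ‖a - b‖ η with h | h
      · linarith
      · have : ‖a - b‖ ≤ 8 * (1 + R) ^ 3 / η * D := by
          rw [div_mul_eq_mul_div, le_div_iff₀ hη]
          nlinarith [norm_nonneg (a - b)]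
        linarith
    · have := key b a (by linarith) hb
      rw [norm_sub_rev] at this
      linarith
  · rcases le_total ‖b‖ ‖a‖ with h | h
    · have := key a b h ha
      linarith
    · have := key b a h (by linarith)
      rw [norm_sub_rev] at this
      linarith

variable {F Ω : Type*} [NormedAddCommGroup F] [MeasurableSpace Ω] {m : Measure Ω}

lemma norm_le_one_add_rpow {p : ℝ} (hp : 1 < p) (v : F) : ‖v‖ ≤ 1 + ‖v‖ ^ p := by
  rcases le_total ‖v‖ 1 with h | h
  · have : 0 ≤ ‖v‖ ^ p := by positivity
    linarith
  · have := Real.self_le_rpow_of_one_le h hp.le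
    linarith

lemma integrable_of_integrable_rpow [IsFiniteMeasure m] {p : ℝ} (hp : 1 < p) {φ : Ω → F}
    (hφ : AEStronglyMeasurable φ m) (hi : Integrable (fun ω => ‖φ ω‖ ^ p) m) :
    Integrable φ m :=
  ((integrable_const (1 : ℝ)).add hi).mono' hφ (ae_of_all _ fun _ => norm_le_one_add_rpow hp _)

/-- The functions with `p`-th moment at most `C` form a convex set. -/
lemma convex_setOf_integral_rpow_le {p : ℝ} (hp : 1 < p) (C : ℝ) :
    Convex ℝ {φ : Ω → E | AEStronglyMeasurable φ m ∧ Integrable (fun ω => ‖φ ω‖ ^ p) m ∧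
      ∫ ω, ‖φ ω‖ ^ p ∂m ≤ C} := by
  rintro φ ⟨hφ1, hφ2, hφ3⟩ χ ⟨hχ1, hχ2, hχ3⟩ a b ha hb hab
  have hpt : ∀ ω, ‖(a • φ + b • χ) ω‖ ^ p ≤ a * ‖φ ω‖ ^ p + b * ‖χ ω‖ ^ p := by
    intro ω
    have h1 : ‖(a • φ + b • χ) ω‖ ≤ a * ‖φ ω‖ + b * ‖χ ω‖ := by
      refine (norm_add_le _ _).trans_eq ?_
      simp [norm_smul, abs_of_nonneg ha, abs_of_nonneg hb]
    refine (Real.rpow_le_rpow (norm_nonneg _) h1 (by linarith)).trans ?_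
    exact (convexOn_rpow hp.le).2 (norm_nonneg (φ ω)) (norm_nonneg (χ ω)) ha hb hab
  have hm : AEStronglyMeasurable (a • φ + b • χ) m := (hφ1.const_smul a).add (hχ1.const_smul b)
  have hI : Integrable (fun ω => a * ‖φ ω‖ ^ p + b * ‖χ ω‖ ^ p) m :=
    (hφ2.const_mul a).add (hχ2.const_mul b)
  have hJ : Integrable (fun ω => ‖(a • φ + b • χ) ω‖ ^ p) m := by
    refine hI.mono' (hm.norm.aemeasurable.pow_const p).aestronglyMeasurable (ae_of_all _ fun ω => ?_)
    rw [Real.norm_of_nonneg (by positivity)]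
    exact hpt ω
  refine ⟨hm, hJ, ?_⟩
  calc ∫ ω, ‖(a • φ + b • χ) ω‖ ^ p ∂m ≤ ∫ ω, (a * ‖φ ω‖ ^ p + b * ‖χ ω‖ ^ p) ∂m :=
        integral_mono hJ hI hpt
    _ = a * ∫ ω, ‖φ ω‖ ^ p ∂m + b * ∫ ω, ‖χ ω‖ ^ p ∂m := by
        rw [integral_add (hφ2.const_mul a) (hχ2.const_mul b), integral_const_mul,
          integral_const_mul]
    _ ≤ a * C + b * C := by gcongr
    _ = C := by rw [← add_mul, hab, one_mul]

lemma integrable_bracket [IsFiniteMeasure m] {φ : Ω → F} (hφ : Integrable φ m) :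
    Integrable (fun ω => √(1 + ‖φ ω‖ ^ 2)) m := by
  refine ((integrable_const (1 : ℝ)).add hφ.norm).mono' ?_ (ae_of_all _ fun ω => ?_)
  · exact (((hφ.1.norm.pow 2).const_add 1).aemeasurable.sqrt).aestronglyMeasurable
  · rw [Real.norm_of_nonneg (by positivity), Pi.add_apply]
    rw [Real.sqrt_le_left (by positivity)]
    nlinarith [norm_nonneg (φ ω)]

lemma integrable_rpow_of_lintegral_le {p : ℝ} (hp : 0 ≤ p) {φ : Ω → F} {C : ℝ≥0∞} (hC : C ≠ ⊤)
    (hφ : AEStronglyMeasurable φ m) (h : ∫⁻ ω, ‖φ ω‖ₑ ^ p ∂m ≤ C) :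
    Integrable (fun ω => ‖φ ω‖ ^ p) m ∧ ∫ ω, ‖φ ω‖ ^ p ∂m ≤ C.toReal := by
  have hm : AEStronglyMeasurable (fun ω => ‖φ ω‖ ^ p) m :=
    (hφ.norm.aemeasurable.pow_const p).aestronglyMeasurable
  have he : ∀ ω, ENNReal.ofReal (‖φ ω‖ ^ p) = ‖φ ω‖ₑ ^ p := fun ω => by
    rw [← ENNReal.ofReal_rpow_of_nonneg (norm_nonneg _) hp, ofReal_norm]
  have h0 : 0 ≤ᵐ[m] fun ω => ‖φ ω‖ ^ p := ae_of_all _ fun ω => by positivity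
  constructor
  · refine ⟨hm, ?_⟩
    rw [hasFiniteIntegral_iff_ofReal h0]
    simp_rw [he]
    exact h.trans_lt hC.lt_top
  · rw [integral_eq_lintegral_of_nonneg_ae h0 hm]
    simp_rw [he]
    exact ENNReal.toReal_mono hC h

/-- A sequence of functions bounded in `L^p`, `p > 1`, has convex combinations of its tails that
converge in `L^1` and almost everywhere. -/
theorem exists_convexHull_tendsto [IsFiniteMeasure m] [CompleteSpace E] {p C : ℝ} (hp : 1 < p) (f : ℕ → Ω → E)
    (hf : ∀ n, AEStronglyMeasurable (f n) m) (hfi : ∀ n, Integrable (fun ω => ‖f n ω‖ ^ p) m)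
    (hC : ∀ n, ∫ ω, ‖f n ω‖ ^ p ∂m ≤ C) :
    ∃ (g : ℕ → Ω → E) (G : Ω → E), (∀ n, g n ∈ convexHull ℝ (f '' Ici n)) ∧
      (∀ n, Integrable (g n) m) ∧ Integrable G m ∧
      Tendsto (fun n => ∫ ω, ‖g n ω - G ω‖ ∂m) atTop (𝓝 0) ∧
      ∀ᵐ ω ∂m, Tendsto (fun n => g n ω) atTop (𝓝 (G ω)) := by
  set S := {φ : Ω → E | AEStronglyMeasurable φ m ∧ Integrable (fun ω => ‖φ ω‖ ^ p) m ∧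
      ∫ ω, ‖φ ω‖ ^ p ∂m ≤ C}
  set K : ℕ → Set (Ω → E) := fun n => convexHull ℝ (f '' Ici n)
  have hKS : ∀ n, K n ⊆ S := fun n => convexHull_min (by
    rintro _ ⟨k, -, rfl⟩; exact ⟨hf k, hfi k, hC k⟩) (convex_setOf_integral_rpow_le hp C)
  have hKanti : ∀ {k l}, k ≤ l → K l ⊆ K k := fun h =>
    convexHull_mono (image_mono (Ici_subset_Ici.2 h))
  have hKint : ∀ n, ∀ φ ∈ K n, Integrable φ m := fun n φ hφ =>
    integrable_of_integrable_rpow hp (hKS n hφ).1 (hKS n hφ).2.1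
  -- The infimum of this strictly convex functional over the hull of the `n`-th tail increases with
  -- `n` and stays bounded. Near-minimizers are Cauchy in `L^1`, because their midpoints stay in an
  -- earlier hull and cannot do much better.
  set J : (Ω → E) → ℝ := fun φ => ∫ ω, √(1 + ‖φ ω‖ ^ 2) ∂m
  have hJ0 : ∀ φ, 0 ≤ J φ := fun φ => integral_nonneg fun ω => Real.sqrt_nonneg _
  set j : ℕ → ℝ := fun n => sInf (J '' K n)
  have hbdd : ∀ n, BddBelow (J '' K n) := fun n => ⟨0, by rintro _ ⟨φ, -, rfl⟩; exact hJ0 φ⟩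
  have hne : ∀ n, (J '' K n).Nonempty := fun n =>
    ⟨_, mem_image_of_mem J (subset_convexHull ℝ _ (mem_image_of_mem f (mem_Ici.2 le_rfl)))⟩
  have hjmono : Monotone j := fun k l hkl =>
    csInf_le_csInf (hbdd k) (hne l) (image_mono (hKanti hkl))
  have hjbdd : BddAbove (range j) := by
    refine ⟨∫ ω, (2 : ℝ) ∂m + C, ?_⟩
    rintro _ ⟨n, rfl⟩
    have hmem : f n ∈ K n := subset_convexHull ℝ _ (mem_image_of_mem f (mem_Ici.2 le_rfl))
    refine (csInf_le (hbdd n) (mem_image_of_mem J hmem)).trans ?_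
    calc J (f n) ≤ ∫ ω, (2 + ‖f n ω‖ ^ p) ∂m := by
          refine integral_mono (integrable_bracket (hKint n _ hmem))
            ((integrable_const _).add (hfi n)) fun ω => ?_
          have h1 := norm_le_one_add_rpow hp (f n ω)
          have h2 : √(1 + ‖f n ω‖ ^ 2) ≤ 1 + ‖f n ω‖ := by
            rw [Real.sqrt_le_left (by positivity)]
            nlinarith [norm_nonneg (f n ω)]
          show √(1 + ‖f n ω‖ ^ 2) ≤ 2 + ‖f n ω‖ ^ p
          linarith
      _ = ∫ ω, (2 : ℝ) ∂m + ∫ ω, ‖f n ω‖ ^ p ∂m := integral_add (integrable_const _) (hfi n)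
      _ ≤ _ := by gcongr; exact hC n
  have hjlim : Tendsto j atTop (𝓝 (⨆ n, j n)) := tendsto_atTop_ciSup hjmono hjbdd
  have hex : ∀ n : ℕ, ∃ φ ∈ K n, J φ < j n + 1 / ((n : ℝ) + 1) := by
    intro n
    obtain ⟨_, ⟨φ, hφ, rfl⟩, hlt⟩ := exists_lt_of_csInf_lt (hne n)
      (show sInf (J '' K n) < j n + 1 / ((n : ℝ) + 1) by
        have : (0 : ℝ) < 1 / ((n : ℝ) + 1) := by positivity
        simp only [j]; linarith)
    exact ⟨φ, hφ, hlt⟩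
  choose g hgK hgJ using hex
  have hgi : ∀ n, Integrable (g n) m := fun n => hKint n _ (hgK n)
  have hC0 : 0 ≤ C := (integral_nonneg fun ω => by positivity).trans (hC 0)
  have hcauchy : ∀ δ > 0, ∃ N, ∀ k ≥ N, ∀ l ≥ N, ∫ ω, ‖g k ω - g l ω‖ ∂m < δ := by
    intro δ hδ
    -- The two terms carrying `η` add up to less than `δ / 2`; the convexity gap contributes at most
    -- twice a quantity below `δ / 4`.
    set η := δ / (2 * (m.real univ + 2 * C + 1))
    have hη : 0 < η := by positivity
    obtain ⟨c, hc0, hc⟩ := exists_norm_sub_le_bracket (E := E) hp hη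
    have hlim : Tendsto (fun n : ℕ => c * (((⨆ n, j n) - j n) / 2 + 1 / ((n : ℝ) + 1)))
        atTop (𝓝 (c * (((⨆ n, j n) - ⨆ n, j n) / 2 + 0))) :=
      (((tendsto_const_nhds.sub hjlim).div_const 2).add
        tendsto_one_div_add_atTop_nhds_zero_nat).const_mul c
    rw [sub_self, zero_div, add_zero, mul_zero] at hlim
    obtain ⟨N, hN⟩ := eventually_atTop.1 (hlim.eventually_lt_const (show 0 < δ / 4 by positivity))
    refine ⟨N, fun k hk l hl => ?_⟩
    have hmid : (1 / 2 : ℝ) • (g k + g l) ∈ K N := by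
      rw [smul_add]
      exact convex_convexHull ℝ _ (hKanti hk (hgK k)) (hKanti hl (hgK l)) (by norm_num)
        (by norm_num) (by norm_num)
    have hmidJ : j N ≤ J ((1 / 2 : ℝ) • (g k + g l)) := csInf_le (hbdd N) (mem_image_of_mem J hmid)
    have hkJ : J (g k) ≤ (⨆ n, j n) + 1 / ((N : ℝ) + 1) := by
      have h1 : j k ≤ ⨆ n, j n := le_ciSup hjbdd k
      have h2 : 1 / ((k : ℝ) + 1) ≤ 1 / ((N : ℝ) + 1) := by gcongr
      linarith [hgJ k]
    have hlJ : J (g l) ≤ (⨆ n, j n) + 1 / ((N : ℝ) + 1) := by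
      have h1 : j l ≤ ⨆ n, j n := le_ciSup hjbdd l
      have h2 : 1 / ((l : ℝ) + 1) ≤ 1 / ((N : ℝ) + 1) := by gcongr
      linarith [hgJ l]
    have i1 := integrable_bracket (hgi k)
    have i2 := integrable_bracket (hgi l)
    have i3 := integrable_bracket (hKint N _ hmid)
    have i4 := (hKS k (hgK k)).2.1
    have i5 := (hKS l (hgK l)).2.1
    have i12 : Integrable (fun ω => (√(1 + ‖g k ω‖ ^ 2) + √(1 + ‖g l ω‖ ^ 2)) / 2) m :=
      (i1.add i2).div_const 2
    have i123 : Integrable (fun ω => c * ((√(1 + ‖g k ω‖ ^ 2) + √(1 + ‖g l ω‖ ^ 2)) / 2 -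
        √(1 + ‖((1 / 2 : ℝ) • (g k + g l)) ω‖ ^ 2))) m := (i12.sub i3).const_mul c
    have i45 : Integrable (fun ω => η * (‖g k ω‖ ^ p + ‖g l ω‖ ^ p)) m := (i4.add i5).const_mul η
    have i0 : Integrable (fun ω => η + c * ((√(1 + ‖g k ω‖ ^ 2) + √(1 + ‖g l ω‖ ^ 2)) / 2 -
        √(1 + ‖((1 / 2 : ℝ) • (g k + g l)) ω‖ ^ 2))) m := (integrable_const _).add i123
    calc ∫ ω, ‖g k ω - g l ω‖ ∂m
        ≤ ∫ ω, (η + c * ((√(1 + ‖g k ω‖ ^ 2) + √(1 + ‖g l ω‖ ^ 2)) / 2 -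
            √(1 + ‖((1 / 2 : ℝ) • (g k + g l)) ω‖ ^ 2)) +
            η * (‖g k ω‖ ^ p + ‖g l ω‖ ^ p)) ∂m := by
          refine integral_mono ((hgi k).sub (hgi l)).norm
            (i0.add i45) fun ω => ?_
          exact hc (g k ω) (g l ω)
      _ = m.real univ * η + c * ((J (g k) + J (g l)) / 2 - J ((1 / 2 : ℝ) • (g k + g l))) +
            η * (∫ ω, ‖g k ω‖ ^ p ∂m + ∫ ω, ‖g l ω‖ ^ p ∂m) := by
          rw [integral_add i0 i45,
            integral_add (integrable_const _) i123, integral_const, integral_const_mul,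
            integral_const_mul, integral_add i4 i5, integral_sub i12 i3, integral_div,
            integral_add i1 i2, smul_eq_mul]
      _ ≤ m.real univ * η + c * (((⨆ n, j n) - j N) / 2 + 1 / ((N : ℝ) + 1)) * 2 +
            η * (C + C) := by
          have hb1 := (hKS k (hgK k)).2.2
          have hb2 := (hKS l (hgK l)).2.2
          have hN0 : 0 ≤ 1 / ((N : ℝ) + 1) := by positivity
          rw [mul_assoc c]
          gcongr
          linarith
      _ < δ := by
          have h1 := hN N le_rfl
          have h2 : η * (2 * (m.real univ + 2 * C + 1)) = δ := div_mul_cancel₀ _ (by positivity)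
          linarith
  have hLp : ∀ k l, dist ((hgi k).toL1 (g k)) ((hgi l).toL1 (g l)) = ∫ ω, ‖g k ω - g l ω‖ ∂m := by
    intro k l
    rw [dist_eq_norm, ← Integrable.toL1_sub, L1.norm_of_fun_eq_integral_norm]
    rfl
  have hcs : CauchySeq fun n => (hgi n).toL1 (g n) := by
    rw [Metric.cauchySeq_iff]
    intro δ hδ
    obtain ⟨N, hN⟩ := hcauchy δ hδ
    exact ⟨N, fun k hk l hl => by rw [hLp]; exact hN k hk l hl⟩
  obtain ⟨G, hG⟩ := cauchySeq_tendsto_of_complete hcs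
  have hGi : Integrable G m := L1.integrable_coeFn G
  have hdist : ∀ n, dist ((hgi n).toL1 (g n)) G = ∫ ω, ‖g n ω - G ω‖ ∂m := by
    intro n
    conv_lhs => rw [dist_eq_norm, ← Integrable.toL1_coeFn G hGi]
    rw [← Integrable.toL1_sub, L1.norm_of_fun_eq_integral_norm]
    rfl
  have hlim : Tendsto (fun n => ∫ ω, ‖g n ω - G ω‖ ∂m) atTop (𝓝 0) := by
    simp_rw [← hdist]
    exact tendsto_iff_dist_tendsto_zero.1 hG
  have hmeas : TendstoInMeasure m g atTop G := by
    refine tendstoInMeasure_of_tendsto_eLpNorm one_ne_zero (fun n => (hgi n).1) hGi.1 ?_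
    have : ∀ n, eLpNorm (g n - ⇑G) 1 m = ENNReal.ofReal (∫ ω, ‖g n ω - G ω‖ ∂m) := by
      intro n
      rw [eLpNorm_one_eq_lintegral_enorm]
      exact (ofReal_integral_norm_eq_lintegral_enorm ((hgi n).sub hGi)).symm
    simp_rw [this]
    simpa using ENNReal.tendsto_ofReal hlim
  obtain ⟨ns, hns, hae⟩ := hmeas.exists_seq_tendsto_ae
  exact ⟨fun n => g (ns n), G, fun n => hKanti (hns.id_le n) (hgK (ns n)), fun n => hgi _, hGi,
    hlim.comp hns.tendsto_atTop, hae⟩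

end ConvexCombinations

/-! ### The mean field and integrals over time and `Ξ` -/

/-- The mean field `x ↦ ∫ h γ s x μ(ds)`. -/
noncomputable def meanField {Ξ E : Type*} [MeasurableSpace Ξ] [NormedAddCommGroup E]
    [NormedSpace ℝ E] {γ₀ : ℝ} (μ : Measure Ξ) (h : Ioo (0 : ℝ) γ₀ → Ξ → E → E)
    (γ : Ioo (0 : ℝ) γ₀) (x : E) : E :=
  ∫ s, h γ s x ∂μ

/-- The integral of a function over `[0, t]` and the whole space, as an iterated integral. -/
lemma setIntegral_Iic_prod {Ξ E : Type*} [MeasurableSpace Ξ] [NormedAddCommGroup E]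
    [NormedSpace ℝ E] {μ : Measure Ξ} [SFinite μ] {T t : ℝ} (ht : t ∈ Ioo 0 T) {φ : ℝ × Ξ → E}
    (hφ : Integrable φ ((volume.restrict (Ioo 0 T)).prod μ)) :
    ∫ z in Iic t ×ˢ univ, φ z ∂((volume.restrict (Ioo 0 T)).prod μ) =
      ∫ u in (0 : ℝ)..t, ∫ s, φ (u, s) ∂μ := by
  rw [setIntegral_prod _ hφ.integrableOn, Measure.restrict_univ,
    Measure.restrict_restrict measurableSet_Iic, intervalIntegral.integral_of_le ht.1.le]
  congr 2
  ext u
  simp only [mem_inter_iff, mem_Iic, mem_Ioo, mem_Ioc]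
  have := ht.2
  constructor
  · rintro ⟨h1, h2, -⟩; exact ⟨h2, h1⟩
  · rintro ⟨h1, h2⟩; exact ⟨h2, h1, h2.trans_lt this⟩

/-- Through `convexHull_min`, an estimate valid for all functions of a tail passes to their convex
combinations. Integrability belongs to the set because additivity of the integral needs it. -/
lemma convex_setOf_integral_close {Ω E : Type*} [MeasurableSpace Ω]
    [NormedAddCommGroup E] [NormedSpace ℝ E] {m : Measure Ω} (A : Set Ω)
    (v : E) (δ : ℝ) :
    Convex ℝ {φ : Ω → E | Integrable φ m ∧ ∫ z in A, φ z ∂m ∈ Metric.closedBall v δ} := by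
  rintro φ ⟨hφ1, hφ2⟩ χ ⟨hχ1, hχ2⟩ a b ha hb hab
  refine ⟨(hφ1.smul a).add (hχ1.smul b), ?_⟩
  have : ∫ z in A, (a • φ + b • χ) z ∂m = a • ∫ z in A, φ z ∂m + b • ∫ z in A, χ z ∂m := by
    rw [← integral_smul, ← integral_smul]
    exact integral_add (hφ1.smul a).integrableOn (hχ1.smul b).integrableOn
  show ∫ z in A, (a • φ + b • χ) z ∂m ∈ Metric.closedBall v δ
  rw [this]
  exact convex_closedBall v δ hφ2 hχ2 ha hb hab

/-! ### Limits of driven curves satisfy the inclusion -/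

section Inclusion

variable {Ξ E : Type*} [MeasurableSpace Ξ] [NormedAddCommGroup E] [InnerProductSpace ℝ E]
  [FiniteDimensional ℝ E] [MeasurableSpace E] [BorelSpace E] {μ : Measure Ξ}
  [IsProbabilityMeasure μ] {γ₀ : ℝ} {P : Ioo (0 : ℝ) γ₀ → Kernel E E}
  {h : Ioo (0 : ℝ) γ₀ → Ξ → E → E} {H : Ξ → E → Set E}

lemma measurable_meanField (hRM : RM P μ h H) (γ : Ioo (0 : ℝ) γ₀) :
    Measurable (meanField μ h γ) := by
  have : ProperSpace E := FiniteDimensional.proper ℝ E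
  have h1 : StronglyMeasurable (fun p : E × Ξ => h γ p.2 p.1) :=
    ((hRM.measurable γ).comp measurable_swap).stronglyMeasurable
  exact h1.integral_prod_right'.measurable

/-- Limits of curves driven by the mean fields `meanField μ h (γ n)`, `γ n → 0`, along bounded
converging paths solve the differential inclusion of the mean map. -/
theorem ae_hasDerivAt_of_tendsto (hRM : RM P μ h H) {T : ℝ} {γ : ℕ → Ioo (0 : ℝ) γ₀}
    (hγ : Tendsto (fun n => (γ n : ℝ)) atTop (𝓝 0)) {Z : ℕ → ℝ → E}
    (hZ : ∀ n, Measurable (Z n)) {x : ℝ → E}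
    (hZx : ∀ t ∈ Ioo 0 T, Tendsto (fun n => Z n t) atTop (𝓝 (x t))) {R : ℝ}
    (hR : ∀ n, ∀ t ∈ Ioo 0 T, ‖Z n t‖ ≤ R) {x₀ : E}
    (hx : ∀ t ∈ Ioo 0 T, Tendsto (fun n => ∫ u in (0 : ℝ)..t, meanField μ h (γ n) (Z n u))
      atTop (𝓝 (x t - x₀))) :
    ∀ᵐ t ∂(volume.restrict (Ioo 0 T)), ∃ v ∈ meanMap μ H (x t), HasDerivAt x v t := by
  have : ProperSpace E := FiniteDimensional.proper ℝ E
  have : CompleteSpace E := FiniteDimensional.complete ℝ E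
  rcases le_or_gt T 0 with hT0 | hT0
  · simp [Ioo_eq_empty (not_lt.2 hT0)]
  obtain ⟨ε, hε, C, hC⟩ := hRM.moment _ (isCompact_closedBall (0 : E) R)
  set m := (volume.restrict (Ioo 0 T)).prod μ
  -- The limit is taken before averaging over `Ξ`, since closedness and convexity are assumed for
  -- each `H s`.
  set f : ℕ → ℝ × Ξ → E := fun n z => h (γ n) z.2 (Z n z.1)
  have hfm : ∀ n, Measurable (f n) := fun n =>
    (hRM.measurable (γ n)).comp (measurable_snd.prodMk ((hZ n).comp measurable_fst))
  have hbound : ∀ n, ∫⁻ z, ‖f n z‖ₑ ^ (1 + ε) ∂m ≤ C * ENNReal.ofReal T := by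
    intro n
    rw [lintegral_prod _ ((hfm n).enorm.pow_const _).aemeasurable]
    calc ∫⁻ t in Ioo 0 T, ∫⁻ s, ‖f n (t, s)‖ₑ ^ (1 + ε) ∂μ ≤ ∫⁻ t in Ioo 0 T, C := by
          refine setLIntegral_mono measurable_const fun t ht => ?_
          exact (hC (Z n t) (by simpa using hR n t ht) (γ n)).2
      _ = _ := by simp
  have hfin : (C : ℝ≥0∞) * ENNReal.ofReal T ≠ ⊤ := ENNReal.mul_ne_top (by simp) (by simp)
  have hp : 1 < 1 + ε := by linarith
  have hfi := fun n => integrable_rpow_of_lintegral_le (by linarith) hfin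
    (hfm n).aestronglyMeasurable (hbound n)
  have hfint : ∀ n, Integrable (f n) m := fun n =>
    integrable_of_integrable_rpow hp (hfm n).aestronglyMeasurable (hfi n).1
  obtain ⟨g, G, hg, hgi, hGi, hgG, hae⟩ := exists_convexHull_tendsto hp f
    (fun n => (hfm n).aestronglyMeasurable) (fun n => (hfi n).1) (fun n => (hfi n).2)
  have hmem : ∀ᵐ z ∂m, G z ∈ H z.2 (x z.1) := by
    have h1 : ∀ᵐ z ∂m, z.1 ∈ Ioo 0 T :=
      Measure.quasiMeasurePreserving_fst.ae (ae_restrict_mem measurableSet_Ioo)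
    have h2 := (Measure.quasiMeasurePreserving_snd (μ := volume.restrict (Ioo 0 T)) (ν := μ)).ae
      hRM.tendsto
    have h3 := (Measure.quasiMeasurePreserving_snd (μ := volume.restrict (Ioo 0 T)) (ν := μ)).ae hRM.usc
    filter_upwards [h1, h2, h3, hae] with z hz1 hz2 hz3 hz4
    have hlim := hz2 (fun n => Z n z.1) γ (x z.1) (hZx _ hz1) hγ
    obtain ⟨hcl, hcv⟩ := hz3.2.2 (x z.1)
    rw [← hcl.closure_eq, Metric.closure_eq_iInter_cthickening, mem_iInter₂]
    intro δ hδ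
    obtain ⟨N, hN⟩ := eventually_atTop.1
      (hlim.eventually_le_const (ENNReal.ofReal_pos.2 hδ))
    refine Metric.isClosed_cthickening.mem_of_tendsto hz4 (eventually_atTop.2 ⟨N, fun n hn => ?_⟩)
    -- Thickenings of a convex set are convex, so closeness of the tail to `H s (x t)` is inherited
    -- by its convex combinations, then by their limit.
    have hsub : convexHull ℝ (f '' Ici n) ⊆
        {φ : ℝ × Ξ → E | φ z ∈ Metric.cthickening δ (H z.2 (x z.1))} := by
      refine convexHull_min ?_ ?_
      · rintro _ ⟨k, hk, rfl⟩
        exact Metric.mem_cthickening_iff.2 (hN k (hn.trans hk))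
      · intro φ hφ χ hχ a b ha hb hab
        exact hcv.cthickening δ hφ hχ ha hb hab
    exact hsub (hg n)
  set v : ℝ → E := fun t => ∫ s, G (t, s) ∂μ
  have hGint : ∀ t ∈ Ioo 0 T, ∫ u in (0 : ℝ)..t, v u = x t - x₀ := by
    intro t ht
    rw [← setIntegral_Iic_prod ht hGi]
    have hlim1 : Tendsto (fun n => ∫ z in Iic t ×ˢ univ, g n z ∂m) atTop
        (𝓝 (∫ z in Iic t ×ˢ univ, G z ∂m)) := by
      rw [tendsto_iff_norm_sub_tendsto_zero]
      refine squeeze_zero (fun _ => norm_nonneg _) (fun n => ?_) hgG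
      rw [← integral_sub (hgi n).integrableOn hGi.integrableOn]
      refine (norm_integral_le_integral_norm _).trans ?_
      exact setIntegral_le_integral ((hgi n).sub hGi).norm (ae_of_all _ fun _ => norm_nonneg _)
    refine tendsto_nhds_unique hlim1 ?_
    rw [Metric.tendsto_atTop']
    intro δ hδ
    obtain ⟨N, hN⟩ := Metric.tendsto_atTop.1 (hx t ht) (δ / 2) (half_pos hδ)
    refine ⟨N, fun n hn => ?_⟩
    have hsub : convexHull ℝ (f '' Ici n) ⊆ {φ : ℝ × Ξ → E | Integrable φ m ∧
        ∫ z in Iic t ×ˢ univ, φ z ∂m ∈ Metric.closedBall (x t - x₀) (δ / 2)} := by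
      refine convexHull_min ?_ (convex_setOf_integral_close _ _ _)
      rintro _ ⟨k, hk, rfl⟩
      refine ⟨hfint k, ?_⟩
      rw [setIntegral_Iic_prod ht (hfint k)]
      exact (hN k (hn.le.trans hk)).le
    exact ((hsub (hg n)).2 : dist _ _ ≤ δ / 2).trans_lt (half_lt_self hδ)
  have hvi : IntervalIntegrable v volume 0 T := by
    rw [intervalIntegrable_iff_integrableOn_Ioo_of_le hT0.le]
    exact hGi.integral_prod_left
  have hder := hvi.ae_hasDerivAt_integral
  rw [ae_restrict_iff' measurableSet_Ioo]
  have hsel := (ae_restrict_iff' measurableSet_Ioo).1 (Measure.ae_ae_of_ae_prod hmem)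
  have hseli := (ae_restrict_iff' measurableSet_Ioo).1 hGi.prod_right_ae
  filter_upwards [hder, hsel, hseli] with t h1 h2 h3 ht
  -- For almost every `t` the slice `G (t, ·)` is an integrable selection of `H · (x t)`, with
  -- integral `v t`.
  refine ⟨v t, subset_closure ⟨fun s => G (t, s), ⟨h3 ht, h2 ht⟩, rfl⟩, ?_⟩
  rw [uIcc_of_le hT0.le] at h1
  have h4 := (h1 (Ioo_subset_Icc_self ht) 0 (left_mem_Icc.2 hT0.le)).const_add x₀
  refine h4.congr_of_eventuallyEq ?_
  filter_upwards [Ioo_mem_nhds ht.1 ht.2] with u hu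
  rw [hGint u hu]
  abel

end Inclusion

/-! ### Extraction of convergent Lipschitz curves -/

/-- A sequence of curves on `[0, ∞)`, bounded at `0` and eventually uniformly Lipschitz on every
`[0, T]`, has a pointwise convergent subsequence. -/
lemma exists_subseq_tendsto_of_lipschitz {E : Type*} [NormedAddCommGroup E] [ProperSpace E]
    {y : ℕ → ℝ → E} {C : ℝ} (h0 : ∀ n, ‖y n 0‖ ≤ C) {L : ℝ → ℝ≥0}
    (hL : ∀ T, ∀ᶠ n in atTop, LipschitzOnWith (L T) (y n) (Icc 0 T)) :
    ∃ φ : ℕ → ℕ, StrictMono φ ∧ ∃ x : ℝ → E, (∀ T, LipschitzOnWith (L T) x (Icc 0 T)) ∧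
      ∀ t, 0 ≤ t → Tendsto (fun n => y (φ n) t) atTop (𝓝 (x t)) := by
  have hB : ∀ q : ℚ≥0, ∃ B, ∀ n, ‖y n q‖ ≤ B := by
    intro q
    have hq : (0 : ℝ) ≤ q := NNRat.cast_nonneg q
    obtain ⟨N, hN⟩ := eventually_atTop.1 (hL q)
    -- The finite sum covers the indices before the Lipschitz bound takes effect.
    refine ⟨C + L q * q + ∑ n ∈ Finset.range N, ‖y n q‖, fun n => ?_⟩
    have hC : 0 ≤ C := (norm_nonneg _).trans (h0 0)
    rcases lt_or_ge n N with hn | hn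
    · have h1 : ‖y n q‖ ≤ ∑ n ∈ Finset.range N, ‖y n q‖ :=
        Finset.single_le_sum (f := fun n => ‖y n q‖) (fun _ _ => norm_nonneg _)
          (Finset.mem_range.2 hn)
      have h2 : 0 ≤ (L q : ℝ) * q := by positivity
      linarith
    · have h1 := (hN n hn).dist_le_mul _ (right_mem_Icc.2 hq) _ (left_mem_Icc.2 hq)
      rw [dist_eq_norm, Real.dist_eq, sub_zero, abs_of_nonneg hq] at h1
      have h2 : ‖y n q‖ ≤ ‖y n q - y n 0‖ + ‖y n 0‖ := by
        simpa using norm_add_le (y n q - y n 0) (y n 0)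
      have h3 : 0 ≤ ∑ n ∈ Finset.range N, ‖y n q‖ := Finset.sum_nonneg fun _ _ => norm_nonneg _
      linarith [h0 n]
  choose B hB using hB
  -- Sequential compactness of a countable product of balls replaces the diagonal extraction over
  -- rational times.
  obtain ⟨a, -, φ, hφ, ha⟩ := (isCompact_univ_pi fun q : ℚ≥0 =>
    isCompact_closedBall (0 : E) (B q)).tendsto_subseq (x := fun n (q : ℚ≥0) => y n q)
    fun n q _ => by simpa using hB q n
  rw [tendsto_pi_nhds] at ha
  have hex : ∀ t : ℝ, ∃ b, 0 ≤ t → Tendsto (fun n => y (φ n) t) atTop (𝓝 b) := by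
    intro t
    by_cases ht : 0 ≤ t
    · have hcs : CauchySeq fun n => y (φ n) t := by
        rw [Metric.cauchySeq_iff']
        intro δ hδ
        set l := (L (t + 1) : ℝ)
        have hl : 0 ≤ l := NNReal.coe_nonneg _
        obtain ⟨q, hq1, hq2⟩ := exists_rat_btwn
          (show t < t + min 1 (δ / (4 * (l + 1))) by
            have : 0 < min 1 (δ / (4 * (l + 1))) := lt_min one_pos (by positivity)
            linarith)
        have hq0 : (0 : ℚ) ≤ q := by exact_mod_cast ht.trans hq1.le
        lift q to ℚ≥0 using hq0
        have hq1' : t < (q : ℝ) := by simpa using hq1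
        have hq2' : (q : ℝ) < t + min 1 (δ / (4 * (l + 1))) := by simpa using hq2
        have hclose : ∀ᶠ n in atTop, dist (y (φ n) t) (y (φ n) q) ≤ δ / 4 := by
          filter_upwards [hφ.tendsto_atTop.eventually (hL (t + 1))] with n hn
          refine (hn.dist_le_mul t ⟨ht, by linarith⟩ q ⟨by linarith, ?_⟩).trans ?_
          · linarith [min_le_left 1 (δ / (4 * (l + 1)))]
          · rw [dist_comm, Real.dist_eq, abs_of_pos (by linarith)]
            calc l * (q - t) ≤ l * (δ / (4 * (l + 1))) := by
                  gcongr
                  linarith [min_le_right 1 (δ / (4 * (l + 1)))]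
              _ ≤ (l + 1) * (δ / (4 * (l + 1))) := by gcongr; linarith
              _ = δ / 4 := by
                  have : l + 1 ≠ 0 := by positivity
                  field_simp
        have hq := Metric.tendsto_atTop.1 (ha q) (δ / 4) (by positivity)
        obtain ⟨N, hN⟩ := hq
        obtain ⟨M, hM⟩ := eventually_atTop.1 hclose
        refine ⟨max N M, fun n hn => ?_⟩
        have h1 := hM n (le_of_max_le_right hn)
        have h2 := hM (max N M) (le_max_right _ _)
        have h3 : dist (y (φ n) q) (a q) < δ / 4 := hN n (le_of_max_le_left hn)
        have h4 : dist (y (φ (max N M)) q) (a q) < δ / 4 := hN _ (le_max_left _ _)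
        rw [dist_comm] at h2 h4
        have := dist_triangle4 (y (φ n) t) (y (φ n) q) (a q) (y (φ (max N M)) t)
        have := dist_triangle (a q) (y (φ (max N M)) q) (y (φ (max N M)) t)
        linarith
      obtain ⟨b, hb⟩ := cauchySeq_tendsto_of_complete hcs
      exact ⟨b, fun _ => hb⟩
    · exact ⟨0, fun h => absurd h ht⟩
  choose x hx using hex
  refine ⟨φ, hφ, x, fun T => ?_, hx⟩
  refine LipschitzOnWith.of_dist_le_mul fun s hs t ht => ?_
  refine le_of_tendsto ((hx s hs.1).dist (hx t ht.1)) ?_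
  filter_upwards [hφ.tendsto_atTop.eventually (hL T)] with n hn
  exact hn.dist_le_mul s hs t ht

/-! ### Piecewise constant velocities -/

section StepPaths

variable {E : Type*} [NormedAddCommGroup E]

lemma mul_floor_div_le {γ u : ℝ} (hγ : 0 < γ) (hu : 0 ≤ u) : γ * ⌊u / γ⌋₊ ≤ u := by
  have := Nat.floor_le (div_nonneg hu hγ.le)
  rwa [le_div_iff₀ hγ, mul_comm] at this

lemma lt_mul_floor_div_add {γ u : ℝ} (hγ : 0 < γ) : u < γ * ⌊u / γ⌋₊ + γ := by
  have := Nat.lt_floor_add_one (u / γ)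
  rw [div_lt_iff₀ hγ] at this
  linarith

lemma floor_div_lt {γ u : ℝ} (hγ : 0 < γ) (hu : 0 ≤ u) {k : ℕ} (h : u < γ * k) :
    ⌊u / γ⌋₊ < k := by
  rw [Nat.floor_lt (div_nonneg hu hγ.le), div_lt_iff₀ hγ]
  linarith

lemma tendsto_mul_floor_div {γ : ℕ → ℝ} (hγ0 : ∀ n, 0 < γ n) (hγ : Tendsto γ atTop (𝓝 0))
    {u : ℝ} (hu : 0 ≤ u) : Tendsto (fun n => γ n * ⌊u / γ n⌋₊) atTop (𝓝 u) := by
  have h1 : Tendsto (fun n => u - γ n) atTop (𝓝 u) := by simpa using tendsto_const_nhds.sub hγ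
  refine tendsto_of_tendsto_of_tendsto_of_le_of_le h1 tendsto_const_nhds (fun n => ?_)
    fun n => mul_floor_div_le (hγ0 n) hu
  have := lt_mul_floor_div_add (u := u) (hγ0 n)
  show u - γ n ≤ _
  linarith

/-- The piecewise constant curve with value `w k` on `[γ k, γ (k + 1))`, for `k < κ`. -/
noncomputable def stepCurve (γ : ℝ) (κ : ℕ) (w : ℕ → E) (u : ℝ) : E :=
  if u < γ * κ then w ⌊u / γ⌋₊ else 0

lemma norm_stepCurve_le {γ T L u : ℝ} {κ : ℕ} {w : ℕ → E} (hγ : 0 < γ) (hL : 0 ≤ L)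
    (hw : ∀ k < κ, γ * k ≤ T → ‖w k‖ ≤ L) (hu : u ∈ Icc 0 T) : ‖stepCurve γ κ w u‖ ≤ L := by
  unfold stepCurve
  split_ifs with h
  · exact hw _ (floor_div_lt hγ hu.1 h) ((mul_floor_div_le hγ hu.1).trans hu.2)
  · simpa using hL

lemma stronglyMeasurable_stepCurve (γ : ℝ) (κ : ℕ) (w : ℕ → E) :
    StronglyMeasurable (stepCurve γ κ w) := by
  refine StronglyMeasurable.ite measurableSet_Iio ?_ stronglyMeasurable_const
  have : Measurable fun u : ℝ => ⌊u / γ⌋₊ := Nat.measurable_floor.comp (measurable_id.div_const γ)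
  exact (StronglyMeasurable.of_discrete (f := w)).comp_measurable this

lemma intervalIntegrable_stepCurve {γ T L s t : ℝ} {κ : ℕ} {w : ℕ → E} (hγ : 0 < γ) (hL : 0 ≤ L)
    (hw : ∀ k < κ, γ * k ≤ T → ‖w k‖ ≤ L) (hs : s ∈ Icc 0 T) (ht : t ∈ Icc 0 T) :
    IntervalIntegrable (stepCurve γ κ w) volume s t := by
  rw [intervalIntegrable_iff]
  refine Integrable.mono' (g := fun _ => L) (integrableOn_const (by simp [uIoc]))
    (stronglyMeasurable_stepCurve γ κ w).aestronglyMeasurable ?_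
  rw [ae_restrict_iff' measurableSet_uIoc]
  refine ae_of_all _ fun u hu => norm_stepCurve_le hγ hL hw ?_
  rw [← uIcc_of_le (hs.1.trans hs.2)] at *
  exact uIcc_subset_uIcc hs ht (uIoc_subset_uIcc hu)

variable [NormedSpace ℝ E] [CompleteSpace E]

/-- At grid times the primitive equals the discrete sum, which makes the interpolated curve
comparable with the discrete path. -/
lemma integral_stepCurve {γ : ℝ} (hγ : 0 < γ) {κ k : ℕ} (hk : k ≤ κ) (w : ℕ → E) :
    ∫ u in (0 : ℝ)..(γ * k), stepCurve γ κ w u = γ • ∑ l ∈ Finset.range k, w l := by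
  have hae : ∀ l < k, ∀ u ∈ Ioo (γ * l) (γ * (l + 1 : ℕ)), stepCurve γ κ w u = w l := by
    intro l hl u hu
    have hfl : ⌊u / γ⌋₊ = l := by
      rw [Nat.floor_eq_iff (div_nonneg ((by positivity : 0 ≤ γ * l).trans hu.1.le) hγ.le),
        le_div_iff₀ hγ, div_lt_iff₀ hγ]
      constructor
      · linarith [hu.1]
      · have := hu.2
        push_cast at this
        linarith
    unfold stepCurve
    rw [hfl, if_pos]
    refine hu.2.trans_le ?_
    gcongr
    omega
  have hle : ∀ l : ℕ, γ * l ≤ γ * (l + 1 : ℕ) := fun l => by gcongr; simp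
  have hint : ∀ l < k, IntervalIntegrable (stepCurve γ κ w) volume (γ * l) (γ * (l + 1 : ℕ)) := by
    intro l hl
    rw [intervalIntegrable_iff_integrableOn_Ioo_of_le (hle l)]
    exact (integrableOn_const (C := w l) (by simp)).congr_fun (fun u hu => (hae l hl u hu).symm)
      measurableSet_Ioo
  have hsum := intervalIntegral.sum_integral_adjacent_intervals (a := fun l : ℕ => γ * l) hint
  simp only [Nat.cast_zero, mul_zero] at hsum
  rw [← hsum, Finset.smul_sum]
  refine Finset.sum_congr rfl fun l hl => ?_
  rw [intervalIntegral.integral_of_le (hle l), integral_Ioc_eq_integral_Ioo,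
    setIntegral_congr_fun measurableSet_Ioo (hae l (Finset.mem_range.1 hl)), setIntegral_const]
  congr 1
  simp [measureReal_def, ← mul_sub, hγ.le]

end StepPaths

/-! ### Limits of discrete paths -/

section PathLimit

variable {Ξ E : Type*} [MeasurableSpace Ξ] [NormedAddCommGroup E] [InnerProductSpace ℝ E]
  [FiniteDimensional ℝ E] [MeasurableSpace E] [BorelSpace E] {μ : Measure Ξ}
  [IsProbabilityMeasure μ] {γ₀ : ℝ} {P : Ioo (0 : ℝ) γ₀ → Kernel E E}
  {h : Ioo (0 : ℝ) γ₀ → Ξ → E → E} {H : Ξ → E → Set E}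

/-- The moment bound is uniform in `γ`, and `‖v‖ ≤ 1 + ‖v‖ ^ (1 + ε)`. The result supplies Lipschitz
constants for the interpolated curves. -/
lemma exists_norm_meanField_le (hRM : RM P μ h H) (R : ℝ) :
    ∃ L : ℝ, 0 ≤ L ∧ ∀ γ x, ‖x‖ ≤ R → ‖meanField μ h γ x‖ ≤ L := by
  have : ProperSpace E := FiniteDimensional.proper ℝ E
  obtain ⟨ε, hε, C, hC⟩ := hRM.moment _ (isCompact_closedBall (0 : E) R)
  refine ⟨1 + C, by positivity, fun γ x hx => ?_⟩
  have hm : Measurable (fun s => h γ s x) := (hRM.measurable γ).comp measurable_prodMk_right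
  obtain ⟨h1, h2⟩ := integrable_rpow_of_lintegral_le (by linarith) (by simp)
    hm.aestronglyMeasurable (hC x (by simpa using hx) γ).2
  have hp : 1 < 1 + ε := by linarith
  calc ‖meanField μ h γ x‖ ≤ ∫ s, ‖h γ s x‖ ∂μ := norm_integral_le_integral_norm _
    _ ≤ ∫ s, (1 + ‖h γ s x‖ ^ (1 + ε)) ∂μ :=
        integral_mono (integrable_of_integrable_rpow hp hm.aestronglyMeasurable h1).norm
          ((integrable_const _).add h1) fun s => norm_le_one_add_rpow hp _
    _ = 1 + ∫ s, ‖h γ s x‖ ^ (1 + ε) ∂μ := by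
        rw [integral_add (integrable_const _) h1]; simp
    _ ≤ 1 + C := by gcongr; simpa using h2

/-- Discrete paths with step sizes `γ n → 0` which follow the mean fields up to vanishing errors
have a subsequence converging to a solution of the differential inclusion. -/
theorem exists_subseq_tendsto_path (hRM : RM P μ h H) {γ : ℕ → Ioo (0 : ℝ) γ₀}
    (hγ : Tendsto (fun n => (γ n : ℝ)) atTop (𝓝 0)) {ω : ℕ → ℕ → E} {κ : ℕ → ℕ} {η : ℕ → ℝ}
    (hη : Tendsto η atTop (𝓝 0)) {C : ℝ} (h0 : ∀ n, ‖ω n 0‖ ≤ C)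
    (hbd : ∀ T : ℝ, ∃ R : ℝ, ∀ᶠ n in atTop, ∀ k < κ n, (γ n : ℝ) * k ≤ T → ‖ω n k‖ ≤ R)
    (hnoise : ∀ T : ℝ, ∀ᶠ n in atTop, ∀ k ≤ κ n, (γ n : ℝ) * k ≤ T →
      ‖ω n k - ω n 0 - (γ n : ℝ) • ∑ l ∈ Finset.range k, meanField μ h (γ n) (ω n l)‖ ≤ η n) :
    ∃ φ : ℕ → ℕ, StrictMono φ ∧ ∃ x : ℝ → E, (∀ T, ∃ L, LipschitzOnWith L x (Icc 0 T)) ∧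
      (∀ t, 0 ≤ t → ∀ k : ℕ → ℕ, (∀ᶠ n in atTop, k n ≤ κ (φ n)) →
        Tendsto (fun n => (γ (φ n) : ℝ) * k n) atTop (𝓝 t) →
        Tendsto (fun n => ω (φ n) (k n)) atTop (𝓝 (x t))) ∧
      ∀ τ, (∀ᶠ n in atTop, τ ≤ (γ n : ℝ) * κ n) →
        ∀ᵐ t ∂(volume.restrict (Ioo 0 τ)), ∃ v ∈ meanMap μ H (x t), HasDerivAt x v t := by
  have : ProperSpace E := FiniteDimensional.proper ℝ E
  have : CompleteSpace E := FiniteDimensional.complete ℝ E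
  choose R hR using hbd
  choose L hL0 hL using exists_norm_meanField_le hRM
  have hγ0 : ∀ n, 0 < (γ n : ℝ) := fun n => (γ n).2.1
  set w : ℕ → ℕ → E := fun n k => meanField μ h (γ n) (ω n k)
  have hw : ∀ T : ℝ, ∀ᶠ n in atTop, ∀ k < κ n, (γ n : ℝ) * k ≤ T → ‖w n k‖ ≤ L (R T) := by
    intro T
    filter_upwards [hR T] with n hn k hk hkT using hL _ _ _ (hn k hk hkT)
  -- This interpolation leaves out the noise: it is Lipschitz and stays within `η n` of the discrete
  -- path at grid times. The velocity vanishes after step `κ n`, beyond which the path is not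
  -- controlled.
  set y : ℕ → ℝ → E := fun n t => ω n 0 + ∫ u in (0 : ℝ)..t, stepCurve (γ n) (κ n) (w n) u
  have hyL : ∀ T, ∀ᶠ n in atTop, LipschitzOnWith (L (R T)).toNNReal (y n) (Icc 0 T) := by
    intro T
    filter_upwards [hw T] with n hn
    refine LipschitzOnWith.of_dist_le_mul fun s hs t ht => ?_
    have hz : (0 : ℝ) ∈ Icc 0 T := left_mem_Icc.2 (hs.1.trans hs.2)
    have hii := fun s hs t ht => intervalIntegrable_stepCurve (s := s) (t := t) (hγ0 n)
      (hL0 (R T)) hn hs ht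
    simp only [y]
    rw [dist_add_left, dist_eq_norm, intervalIntegral.integral_interval_sub_left
      (hii 0 hz s hs) (hii 0 hz t ht), Real.coe_toNNReal _ (hL0 _), Real.dist_eq]
    refine intervalIntegral.norm_integral_le_of_norm_le_const fun u hu => ?_
    refine norm_stepCurve_le (hγ0 n) (hL0 _) hn ?_
    rw [← uIcc_of_le (hs.1.trans hs.2)] at *
    exact uIcc_subset_uIcc ht hs (uIoc_subset_uIcc hu)
  obtain ⟨φ, hφ, x, hxL, hyx⟩ := exists_subseq_tendsto_of_lipschitz (C := C)
    (fun n => by simpa [y] using h0 n) hyL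
  have hγφ : Tendsto (fun n => (γ (φ n) : ℝ)) atTop (𝓝 0) := hγ.comp hφ.tendsto_atTop
  have hpath : ∀ t, 0 ≤ t → ∀ k : ℕ → ℕ, (∀ᶠ n in atTop, k n ≤ κ (φ n)) →
        Tendsto (fun n => (γ (φ n) : ℝ) * k n) atTop (𝓝 t) →
        Tendsto (fun n => ω (φ n) (k n)) atTop (𝓝 (x t)) := by
    intro t ht k hk hkt
    have h1 : Tendsto (fun n => y (φ n) t) atTop (𝓝 (x t)) := hyx t ht
    have h2 : Tendsto (fun n => ω (φ n) (k n) - y (φ n) t) atTop (𝓝 0) := by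
      have h3 : Tendsto (fun n => η (φ n) + L (R (t + 1)) * |(γ (φ n) : ℝ) * k n - t|) atTop
          (𝓝 (0 + L (R (t + 1)) * |t - t|)) :=
        (hη.comp hφ.tendsto_atTop).add (((hkt.sub_const t).abs).const_mul _)
      simp only [sub_self, abs_zero, mul_zero, add_zero] at h3
      refine squeeze_zero_norm' ?_ h3
      filter_upwards [hk, hkt.eventually_le_const (lt_add_one t),
        hφ.tendsto_atTop.eventually (hnoise (t + 1)),
        hφ.tendsto_atTop.eventually (hyL (t + 1))] with n h4 h5 h6 h7
      have h8 : y (φ n) (γ (φ n) * k n) = ω (φ n) 0 + (γ (φ n) : ℝ) •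
          ∑ l ∈ Finset.range (k n), meanField μ h (γ (φ n)) (ω (φ n) l) := by
        simp only [y, integral_stepCurve (hγ0 (φ n)) h4, w]
      have h9 := h7.dist_le_mul (γ (φ n) * k n) ⟨mul_nonneg (hγ0 _).le (by simp), h5⟩ t
        ⟨ht, by linarith⟩
      rw [Real.coe_toNNReal _ (hL0 _), Real.dist_eq, dist_eq_norm] at h9
      have h10 := h6 (k n) h4 h5
      rw [sub_sub, ← h8] at h10
      calc ‖ω (φ n) (k n) - y (φ n) t‖ = ‖(ω (φ n) (k n) - y (φ n) (γ (φ n) * k n)) +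
            (y (φ n) (γ (φ n) * k n) - y (φ n) t)‖ := by rw [sub_add_sub_cancel]
        _ ≤ _ := norm_add_le_of_le h10 h9
    simpa using h2.add h1
  refine ⟨φ, hφ, x, fun T => ⟨_, hxL T⟩, hpath, fun τ hτ => ?_⟩
  have hτφ : ∀ᶠ n in atTop, τ ≤ (γ (φ n) : ℝ) * κ (φ n) := hφ.tendsto_atTop.eventually hτ
  obtain ⟨N, hN⟩ := eventually_atTop.1 (hτφ.and (hφ.tendsto_atTop.eventually (hR τ)))
  have hfloor : ∀ n ≥ N, ∀ u, 0 ≤ u → u < τ → ⌊u / γ (φ n)⌋₊ < κ (φ n) := fun n hn u hu huτ =>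
    floor_div_lt (hγ0 _) hu (huτ.trans_le (hN n hn).1)
  -- Shifting the index by `N` makes the eventual bounds hold for every `n`.
  refine ae_hasDerivAt_of_tendsto hRM (γ := fun n => γ (φ (n + N)))
    (Z := fun n u => ω (φ (n + N)) ⌊u / γ (φ (n + N))⌋₊) (R := R τ) (x₀ := x 0)
    (hγφ.comp (tendsto_add_atTop_nat N)) (fun n => ?_) (fun t ht => ?_) (fun n t ht => ?_)
    (fun t ht => ?_)
  · have h1 : Measurable fun u : ℝ => ⌊u / (γ (φ (n + N)) : ℝ)⌋₊ :=
      Nat.measurable_floor.comp (measurable_id.div_const _)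
    exact (measurable_from_nat (f := ω (φ (n + N)))).comp h1
  · have h1 := hpath t ht.1.le (fun n => ⌊t / γ (φ n)⌋₊)
      (eventually_atTop.2 ⟨N, fun n hn => (hfloor n hn t ht.1.le ht.2).le⟩)
      (tendsto_mul_floor_div (fun n => hγ0 _) hγφ ht.1.le)
    exact h1.comp (tendsto_add_atTop_nat N)
  · exact (hN (n + N) (by omega)).2 _ (hfloor _ (by omega) t ht.1.le ht.2)
      ((mul_floor_div_le (hγ0 _) ht.1.le).trans ht.2.le)
  · have h1 : Tendsto (fun n => y (φ n) t - y (φ n) 0) atTop (𝓝 (x t - x 0)) :=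
      (hyx t ht.1.le).sub (hyx 0 le_rfl)
    refine (h1.comp (tendsto_add_atTop_nat N)).congr fun n => ?_
    simp only [Function.comp_apply, y, intervalIntegral.integral_same, add_zero,
      add_sub_cancel_left]
    refine intervalIntegral.integral_congr_ae (ae_of_all _ fun u hu => ?_)
    rw [uIoc_of_le ht.1.le] at hu
    rw [stepCurve, if_pos]
    exact (hu.2.trans_lt ht.2).trans_le (hN (n + N) (by omega)).1

end PathLimit

/-! ### Building and continuing solutions -/

section Solutions

variable {E : Type*} [NormedAddCommGroup E]

/-- The clamped shift is monotone and 1-Lipschitz, so it sends disjoint intervals to disjoint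
intervals without increasing their total length. -/
lemma absolutelyContinuousOnInterval_comp_max_sub {f : ℝ → E} {τ T : ℝ} (hτ : 0 ≤ τ) (hT : 0 ≤ T)
    (hf : AbsolutelyContinuousOnInterval f 0 T) :
    AbsolutelyContinuousOnInterval (fun t => f (max (t - τ) 0)) 0 T := by
  rw [absolutelyContinuousOnInterval_iff] at hf ⊢
  intro ε hε
  obtain ⟨δ, hδ, h⟩ := hf ε hε
  refine ⟨δ, hδ, fun I hI hlt => ?_⟩
  refine h (I.1, fun i => (max ((I.2 i).1 - τ) 0, max ((I.2 i).2 - τ) 0)) ⟨fun i hi => ?_, ?_⟩ ?_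
  · obtain ⟨h1, h2⟩ := hI.1 i hi
    rw [uIcc_of_le hT] at *
    exact ⟨⟨le_max_right _ _, max_le (by linarith [h1.2]) hT⟩,
      ⟨le_max_right _ _, max_le (by linarith [h2.2]) hT⟩⟩
  · intro i hi j hj hij
    have := hI.2 hi hj hij
    simp only [Function.onFun, Set.disjoint_left, mem_uIoc] at this ⊢
    intro s hs hs'
    refine this (a := s + τ) ?_ ?_
    · grind
    · grind
  · refine lt_of_le_of_lt (Finset.sum_le_sum fun i _ => ?_) hlt
    simp only [Real.dist_eq]
    refine (abs_max_sub_max_le_abs _ _ _).trans_eq ?_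
    rw [sub_sub_sub_cancel_right]

variable [NormedSpace ℝ E] {F : E → Set E}

/-- A locally Lipschitz curve satisfying the inclusion almost everywhere is a solution. -/
lemma exists_mem_evolution_of_lipschitz {x : ℝ → E}
    (hL : ∀ T, ∃ L, LipschitzOnWith L x (Icc 0 T))
    (hx : ∀ᵐ t ∂(volume.restrict (Ioi (0 : ℝ))), ∃ v ∈ F (x t), HasDerivAt x v t) :
    ∃ u ∈ evolution F (x 0), ∀ t : ℝ≥0, u t = x t := by
  have hc : ContinuousOn x (Ici 0) := by
    intro t ht
    obtain ⟨L, hL⟩ := hL (t + 1)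
    have h1 := hL.continuousOn t ⟨ht, by linarith⟩
    refine h1.mono_of_mem_nhdsWithin ?_
    rw [← Ici_inter_Iic]
    exact inter_mem self_mem_nhdsWithin (mem_nhdsWithin_of_mem_nhds (Iic_mem_nhds (by linarith)))
  refine ⟨⟨fun t => x t, hc.comp_continuous NNReal.continuous_coe fun t => t.2⟩,
    ⟨rfl, fun T hT => ?_, ?_⟩, fun t => rfl⟩
  · obtain ⟨L, hL⟩ := hL T
    refine LipschitzOnWith.absolutelyContinuousOnInterval (K := L) ?_
    rw [uIcc_of_le hT.le]
    intro s hs t ht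
    simpa [hs.1, ht.1] using hL hs ht
  · rw [ae_restrict_iff' measurableSet_Ioi] at hx ⊢
    filter_upwards [hx] with t ht ht0
    obtain ⟨v, hv, hd⟩ := ht ht0
    have h0 : 0 < t := ht0
    refine ⟨v, by simpa [h0.le] using hv, hd.congr_of_eventuallyEq ?_⟩
    filter_upwards [Ioi_mem_nhds h0] with s hs
    have : 0 < s := hs
    simp [this.le]

/-- A Lipschitz curve satisfying the inclusion on `[0, τ]` can be continued by a solution. -/
lemma exists_mem_evolution_concat {x : ℝ → E} {τ : ℝ} (hτ : 0 ≤ τ) {L : ℝ≥0}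
    (hL : LipschitzOnWith L x (Icc 0 τ))
    (hx : ∀ᵐ t ∂(volume.restrict (Ioo 0 τ)), ∃ v ∈ F (x t), HasDerivAt x v t)
    {w : C(ℝ≥0, E)} (hw : w ∈ evolution F (x τ)) :
    ∃ u ∈ evolution F (x 0), u τ.toNNReal = x τ := by
  obtain ⟨hw0, hwac, hwd⟩ := hw
  have hclamp : ∀ t : ℝ, min (max t 0) τ ∈ Icc 0 τ := fun t =>
    ⟨le_min (le_max_right _ _) hτ, min_le_right _ _⟩
  have hXL : LipschitzWith L fun t : ℝ => x (min (max t 0) τ) := by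
    refine LipschitzWith.of_dist_le_mul fun s t => ?_
    refine (hL.dist_le_mul _ (hclamp s) _ (hclamp t)).trans ?_
    gcongr
    simp only [Real.dist_eq]
    have h1 := abs_min_sub_min_le_max (max s 0) τ (max t 0) τ
    have h2 := abs_max_sub_max_le_abs s t 0
    simp only [sub_self, abs_zero] at h1
    exact h1.trans (max_le h2 (abs_nonneg _))
  -- The concatenation is the curve `x` stopped at `τ` plus the later increment of `w`; as a sum, it
  -- inherits absolute continuity from its terms.
  set U : ℝ → E := fun t => x (min (max t 0) τ) + (w (t - τ).toNNReal - w 0)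
  have hU : Continuous U := by
    refine hXL.continuous.add (Continuous.sub ?_ continuous_const)
    exact w.continuous.comp (continuous_real_toNNReal.comp (continuous_id.sub continuous_const))
  have hUpos : ∀ t : ℝ, 0 ≤ t → U (t.toNNReal : ℝ) = U t := fun t ht => by
    rw [Real.coe_toNNReal t ht]
  have hUlt : ∀ t ∈ Icc 0 τ, U t = x t := by
    intro t ht
    simp [U, ht.1, ht.2, Real.toNNReal_of_nonpos (sub_nonpos.2 ht.2)]
  have hUgt : ∀ t, τ ≤ t → U t = w (t - τ).toNNReal := by
    intro t ht
    simp [U, hτ.trans ht, ht, hw0]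
  have hUall : ∀ t : ℝ, U (t.toNNReal : ℝ) = U t := by
    intro t
    rcases le_total 0 t with ht | ht
    · exact hUpos t ht
    · have h1 : t - τ ≤ 0 := by linarith
      simp [U, Real.toNNReal_of_nonpos ht, ht, Real.toNNReal_of_nonpos h1, hτ,
        Real.toNNReal_of_nonpos (neg_nonpos.2 hτ)]
  refine ⟨⟨fun t => U t, hU.comp NNReal.continuous_coe⟩, ⟨?_, fun T hT => ?_, ?_⟩, ?_⟩
  · exact hUlt 0 ⟨le_rfl, hτ⟩
  · simp only [ContinuousMap.coe_mk, hUall]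
    have h1 : AbsolutelyContinuousOnInterval (fun t : ℝ => x (min (max t 0) τ)) 0 T :=
      hXL.lipschitzOnWith.absolutelyContinuousOnInterval
    have h2 := absolutelyContinuousOnInterval_comp_max_sub hτ hT.le (hwac T hT)
    have h3 : AbsolutelyContinuousOnInterval (fun _ : ℝ => w 0) 0 T :=
      ((LipschitzWith.const (w 0)).lipschitzOnWith (s := uIcc 0 T)).absolutelyContinuousOnInterval
    have h4 := h1.add (h2.sub h3)
    convert h4 using 1
    ext t
    simp only [U, Pi.add_apply, Pi.sub_apply]
    congr 3
    rcases le_total 0 (t - τ) with h | h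
    · rw [max_eq_left h]
    · rw [max_eq_right h, Real.toNNReal_of_nonpos h, Real.toNNReal_zero]
  · have hwd' : ∀ᵐ t : ℝ, t - τ ∈ Ioi (0 : ℝ) → ∃ v ∈ F (w (t - τ).toNNReal),
        HasDerivAt (fun s : ℝ => w s.toNNReal) v (t - τ) :=
      (measurePreserving_sub_right volume τ).quasiMeasurePreserving.ae
        ((ae_restrict_iff' measurableSet_Ioi).1 hwd)
    rw [ae_restrict_iff' measurableSet_Ioi]
    rw [ae_restrict_iff' measurableSet_Ioo] at hx
    have hne : ∀ᵐ t : ℝ, t ≠ τ := by simp [ae_iff, measure_singleton]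
    filter_upwards [hx, hwd', hne] with t h1 h2 h3 ht
    simp only [ContinuousMap.coe_mk, hUall]
    have ht0 : 0 < t := ht
    rcases lt_or_gt_of_ne h3 with h | h
    · obtain ⟨v, hv, hd⟩ := h1 ⟨ht0, h⟩
      refine ⟨v, by rwa [hUlt t ⟨ht0.le, h.le⟩], hd.congr_of_eventuallyEq ?_⟩
      filter_upwards [Ioo_mem_nhds ht0 h] with s hs using hUlt s (Ioo_subset_Icc_self hs)
    · obtain ⟨v, hv, hd⟩ := h2 (sub_pos.2 h)
      refine ⟨v, by rwa [hUgt t h.le], (hd.comp_sub_const t τ).congr_of_eventuallyEq ?_⟩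
      filter_upwards [Ioi_mem_nhds h] with s hs using hUgt s (le_of_lt hs)
  · simp only [ContinuousMap.coe_mk, hUall]
    exact hUlt τ ⟨hτ, le_rfl⟩

end Solutions

/-! ### Accumulated deviation from the mean field -/

section Noise

variable {E : Type*} [NormedAddCommGroup E] [NormedSpace ℝ E]

/-- The deviation of a step from the mean field `b`, ignored outside of the ball of radius `R`. -/
noncomputable def noiseStep (b : E → E) (γ R : ℝ) (x y : E) : E :=
  open Classical in if ‖x‖ ≤ R then y - x - γ • b x else 0

/-- The accumulated deviation of a path from the mean field. -/
noncomputable def noiseSum (b : E → E) (γ R : ℝ) (ω : ℕ → E) (k : ℕ) : E :=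
  ∑ l ∈ Finset.range k, noiseStep b γ R (ω l) (ω (l + 1))

/-- The accumulated deviation is at most `ρ` up to time `T`. -/
def NoiseSmall (b : E → E) (γ R T ρ : ℝ) (ω : ℕ → E) : Prop :=
  ∀ k : ℕ, γ * k ≤ T → ‖noiseSum b γ R ω k‖ ≤ ρ

lemma noiseSum_eq {b : E → E} {γ R : ℝ} {ω : ℕ → E} {k : ℕ} (hk : ∀ l < k, ‖ω l‖ ≤ R) :
    noiseSum b γ R ω k = ω k - ω 0 - γ • ∑ l ∈ Finset.range k, b (ω l) := by
  rw [← Finset.sum_range_sub, Finset.smul_sum, ← Finset.sum_sub_distrib]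
  refine Finset.sum_congr rfl fun l hl => ?_
  rw [noiseStep, if_pos (hk l (Finset.mem_range.1 hl))]

end Noise

/-! ### Deterministic consequences of small noise -/

section Deterministic

variable {Ξ E : Type*} [MeasurableSpace Ξ] [NormedAddCommGroup E] [InnerProductSpace ℝ E]
  [FiniteDimensional ℝ E] [MeasurableSpace E] [BorelSpace E] {μ : Measure Ξ}
  [IsProbabilityMeasure μ] {γ₀ : ℝ} {P : Ioo (0 : ℝ) γ₀ → Kernel E E}
  {h : Ioo (0 : ℝ) γ₀ → Ξ → E → E} {H : Ξ → E → Set E}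

/-- Paths with small noise that start in a compact set stay bounded on `[0, T]`. -/
theorem exists_radius_of_noiseSmall (hRM : RM P μ h H) {K : Set E} (hK : IsCompact K) {T : ℝ}
    (hT : 0 < T) :
    ∃ R ρ : ℝ, 0 < ρ ∧ ∀ γ : Ioo (0 : ℝ) γ₀, (γ : ℝ) < ρ → ∀ ω : ℕ → E, ω 0 ∈ K →
      NoiseSmall (meanField μ h γ) γ R T ρ ω → ∀ k : ℕ, (γ : ℝ) * k ≤ T → ‖ω k‖ ≤ R := by
  have : ProperSpace E := FiniteDimensional.proper ℝ E
  -- Solutions from `K` stay in the ball of radius `C` up to time `T`. If discrete paths left the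
  -- ball of radius `C + 1`, a limit stopped at the first exit times would be a solution of norm at
  -- least `C + 1` at a time `τ ≤ T`.
  obtain ⟨C, hC⟩ := hRM.bounded T.toNNReal (by simpa using hT) K hK
  refine ⟨C + 1, ?_⟩
  by_contra! hcon
  have hcon' : ∀ n : ℕ, ∃ γ : Ioo (0 : ℝ) γ₀, (γ : ℝ) < 1 / ((n : ℝ) + 1) ∧ ∃ ω : ℕ → E,
      ω 0 ∈ K ∧ NoiseSmall (meanField μ h γ) γ (C + 1) T (1 / ((n : ℝ) + 1)) ω ∧
      ∃ κ : ℕ, (γ : ℝ) * κ ≤ T ∧ C + 1 < ‖ω κ‖ ∧ ∀ k < κ, ‖ω k‖ ≤ C + 1 := by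
    intro n
    obtain ⟨γ, hγ, ω, hω0, hω, k, hk, hkR⟩ := hcon (1 / ((n : ℝ) + 1)) (by positivity)
    classical
    have hex : ∃ k, C + 1 < ‖ω k‖ := ⟨k, hkR⟩
    refine ⟨γ, hγ, ω, hω0, hω, Nat.find hex, ?_, Nat.find_spec hex, fun l hl =>
      not_lt.1 (Nat.find_min hex hl)⟩
    refine le_trans ?_ hk
    have h1 := γ.2.1
    have h2 : Nat.find hex ≤ k := Nat.find_min' hex hkR
    gcongr
  choose γ hγ ω hω0 hω κ hκT hκR hκ using hcon'
  have hγ0 : ∀ n, 0 < (γ n : ℝ) := fun n => (γ n).2.1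
  have hγlim : Tendsto (fun n => (γ n : ℝ)) atTop (𝓝 0) :=
    squeeze_zero (fun n => (hγ0 n).le) (fun n => (hγ n).le)
      tendsto_one_div_add_atTop_nhds_zero_nat
  obtain ⟨τ, hτ, ψ, hψ, hψτ⟩ := (isCompact_Icc (a := (0 : ℝ)) (b := T)).tendsto_subseq
    (x := fun n => (γ n : ℝ) * κ n) fun n => ⟨mul_nonneg (hγ0 n).le (by simp), hκT n⟩
  obtain ⟨B, hB⟩ := hK.isBounded.exists_norm_le
  obtain ⟨φ, hφ, x, hxL, hpath, hincl⟩ := exists_subseq_tendsto_path hRM (γ := γ ∘ ψ)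
    (ω := ω ∘ ψ) (κ := κ ∘ ψ) (η := fun n => 1 / ((ψ n : ℝ) + 1)) (C := B)
    (hγlim.comp hψ.tendsto_atTop)
    (tendsto_one_div_add_atTop_nhds_zero_nat.comp hψ.tendsto_atTop) (fun n => hB _ (hω0 _))
    (fun T => ⟨C + 1, Eventually.of_forall fun n k hk _ => hκ _ k hk⟩)
    (fun T' => Eventually.of_forall fun n k hk _ => by
      have h1 := hω (ψ n) k (le_trans (by have := hγ0 (ψ n); dsimp at hk; gcongr) (hκT (ψ n)))
      rwa [noiseSum_eq fun l hl => hκ (ψ n) l (hl.trans_le hk)] at h1)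
  have hφτ : Tendsto (fun n => ((γ ∘ ψ) (φ n) : ℝ) * (κ ∘ ψ) (φ n)) atTop (𝓝 τ) :=
    hψτ.comp hφ.tendsto_atTop
  have hxτ : C + 1 ≤ ‖x τ‖ := by
    refine ge_of_tendsto' (hpath τ hτ.1 _ (Eventually.of_forall fun n => le_rfl) hφτ).norm
      fun n => (hκR _).le
  have hx0 : x 0 ∈ K := by
    refine hK.isClosed.mem_of_tendsto (hpath 0 le_rfl (fun _ => 0)
      (Eventually.of_forall fun n => zero_le) (by simp)) (Eventually.of_forall fun n => hω0 _)
  have hae : ∀ᵐ t ∂(volume.restrict (Ioo 0 τ)), ∃ v ∈ meanMap μ H (x t), HasDerivAt x v t := by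
    -- The exit times only converge to `τ`, possibly from below, so the inclusion is first obtained
    -- strictly before `τ`.
    have hU : Ioo 0 τ = ⋃ j : ℕ, Ioo 0 (τ - 1 / ((j : ℝ) + 1)) := by
      ext t
      simp only [mem_Ioo, mem_iUnion]
      constructor
      · rintro ⟨h1, h2⟩
        obtain ⟨j, hj⟩ := exists_nat_one_div_lt (sub_pos.2 h2)
        exact ⟨j, h1, by linarith⟩
      · rintro ⟨j, h1, h2⟩
        have : 0 < 1 / ((j : ℝ) + 1) := by positivity
        exact ⟨h1, by linarith⟩
    rw [hU, ae_restrict_iUnion_iff]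
    intro j
    refine hincl _ (hψτ.eventually_const_le ?_)
    have : 0 < 1 / ((j : ℝ) + 1) := by positivity
    linarith
  obtain ⟨L, hL⟩ := hxL τ
  -- The a priori bound concerns solutions on the whole half-line, so the limit must be continued
  -- beyond `τ`.
  obtain ⟨w, hw⟩ := hRM.exists_solution (x τ)
  obtain ⟨u, hu, huτ⟩ := exists_mem_evolution_concat hτ.1 hL hae hw
  have := hC (x 0) hx0 u hu τ.toNNReal (Real.toNNReal_le_toNNReal hτ.2)
  rw [huτ] at this
  linarith

lemma tendsto_mul_ceil_one_div {γ : ℕ → ℝ} (hγ0 : ∀ n, 0 < γ n) (hγ : Tendsto γ atTop (𝓝 0)) :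
    Tendsto (fun n => γ n * ⌈1 / γ n⌉₊) atTop (𝓝 1) := by
  have h1 : Tendsto (fun n => 1 + γ n) atTop (𝓝 1) := by simpa using hγ.const_add 1
  refine tendsto_of_tendsto_of_tendsto_of_le_of_le tendsto_const_nhds h1 (fun n => ?_) fun n => ?_
  · have := Nat.le_ceil (1 / γ n)
    rw [div_le_iff₀ (hγ0 n)] at this
    show 1 ≤ _
    linarith
  · have h2 := (Nat.ceil_lt_add_one (one_div_pos.2 (hγ0 n)).le).le
    have h3 := mul_le_mul_of_nonneg_left h2 (hγ0 n).le
    rw [mul_add, mul_one, mul_one_div_cancel (hγ0 n).ne'] at h3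
    exact h3

/-- Paths with small noise which return close to their starting point at large times start close to
the Birkhoff center. -/
theorem exists_infEDist_birkhoffCenter_lt (hRM : RM P μ h H) {K : Set E} (hK : IsCompact K)
    {R ρ : ℕ → ℝ} (hρ : ∀ i, 0 < ρ i)
    (hR : ∀ i : ℕ, ∀ γ : Ioo (0 : ℝ) γ₀, (γ : ℝ) < ρ i → ∀ ω : ℕ → E, ω 0 ∈ K →
      NoiseSmall (meanField μ h γ) γ (R i) (i + 1) (ρ i) ω →
      ∀ k : ℕ, (γ : ℝ) * k ≤ i + 1 → ‖ω k‖ ≤ R i)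
    {r : ℕ → ℝ} (hr : Tendsto r atTop (𝓝 0)) (Q : ℕ → ℕ) {ε : ℝ≥0∞} (hε : 0 < ε) :
    ∃ J : ℕ, ∀ γ : Ioo (0 : ℝ) γ₀, (γ : ℝ) < 1 / ((J : ℝ) + 1) → ∀ ω : ℕ → E, ω 0 ∈ K →
      (∀ i ≤ J, NoiseSmall (meanField μ h γ) γ (R i) (i + 1) (1 / ((J : ℝ) + 1)) ω) →
      (∀ i ≤ J, ∃ q ∈ Icc 1 (Q i), dist (ω (q * ((i + 1) * ⌈1 / (γ : ℝ)⌉₊))) (ω 0) ≤ r i) →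
      Metric.infEDist (ω 0) (birkhoffCenter (evolution (meanMap μ H))) < ε := by
  have : ProperSpace E := FiniteDimensional.proper ℝ E
  -- A counterexample for every `J` gives a sequence along which each fixed scale `i` is eventually
  -- controlled; larger scales cover longer horizons.
  by_contra! hcon
  choose γ hγ ω hω0 hω hret hfar using hcon
  have hγ0 : ∀ n, 0 < (γ n : ℝ) := fun n => (γ n).2.1
  have hγlim : Tendsto (fun n => (γ n : ℝ)) atTop (𝓝 0) :=
    squeeze_zero (fun n => (hγ0 n).le) (fun n => (hγ n).le)
      tendsto_one_div_add_atTop_nhds_zero_nat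
  have hbound : ∀ i : ℕ, ∀ᶠ n in atTop, ∀ k : ℕ, (γ n : ℝ) * k ≤ i + 1 → ‖ω n k‖ ≤ R i := by
    intro i
    have h1 : ∀ᶠ n : ℕ in atTop, 1 / ((n : ℝ) + 1) ≤ ρ i :=
      tendsto_one_div_add_atTop_nhds_zero_nat.eventually_le_const (hρ i)
    filter_upwards [h1, eventually_ge_atTop i] with n hn hin
    exact hR i (γ n) ((hγ n).trans_le hn) (ω n) (hω0 n)
      fun k hk => (hω n i hin k hk).trans hn
  have hκ : ∀ n : ℕ, (n : ℝ) ≤ γ n * ⌈(n : ℝ) / γ n⌉₊ := by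
    intro n
    have := Nat.le_ceil ((n : ℝ) / γ n)
    rw [div_le_iff₀ (hγ0 n)] at this
    linarith
  obtain ⟨B, hB⟩ := hK.isBounded.exists_norm_le
  obtain ⟨φ, hφ, x, hxL, hpath, hincl⟩ := exists_subseq_tendsto_path hRM
    (κ := fun n => ⌈(n : ℝ) / γ n⌉₊) (C := B) (ω := ω) hγlim
    tendsto_one_div_add_atTop_nhds_zero_nat (fun n => hB _ (hω0 n))
    (fun T => by
      obtain ⟨i, hi⟩ := exists_nat_ge T
      refine ⟨R i, ?_⟩
      filter_upwards [hbound i] with n hn k _ hk using hn k (by linarith))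
    (fun T => by
      obtain ⟨i, hi⟩ := exists_nat_ge T
      filter_upwards [hbound i, eventually_ge_atTop i] with n hn hin k _ hk
      have h1 := hω n i hin k (by linarith)
      rwa [noiseSum_eq fun l hl => hn l ?_] at h1
      refine le_trans ?_ (by linarith : (γ n : ℝ) * k ≤ i + 1)
      have := hγ0 n
      gcongr)
  have hφlim : Tendsto (fun n => (φ n : ℝ)) atTop atTop :=
    tendsto_natCast_atTop_atTop.comp hφ.tendsto_atTop
  have hpath' : ∀ t, 0 ≤ t → ∀ k : ℕ → ℕ, Tendsto (fun n => (γ (φ n) : ℝ) * k n) atTop (𝓝 t) →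
      Tendsto (fun n => ω (φ n) (k n)) atTop (𝓝 (x t)) := by
    intro t ht k hk
    refine hpath t ht k ?_ hk
    filter_upwards [hk.eventually_le_const (lt_add_one t), hφlim.eventually_ge_atTop (t + 1)]
      with n h1 h2
    have h3 := (h1.trans h2).trans (hκ (φ n))
    exact_mod_cast le_of_mul_le_mul_left h3 (hγ0 _)
  have hae : ∀ᵐ t ∂(volume.restrict (Ioi (0 : ℝ))), ∃ v ∈ meanMap μ H (x t),
      HasDerivAt x v t := by
    have hU : Ioi (0 : ℝ) = ⋃ j : ℕ, Ioo 0 (j : ℝ) := by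
      ext t
      simp only [mem_Ioi, mem_iUnion, mem_Ioo]
      refine ⟨fun ht => ?_, fun ⟨j, h1, _⟩ => h1⟩
      obtain ⟨j, hj⟩ := exists_nat_gt t
      exact ⟨j, ht, hj⟩
    rw [hU, ae_restrict_iUnion_iff]
    intro j
    refine hincl _ ?_
    filter_upwards [eventually_ge_atTop j] with n hn
    exact le_trans (by exact_mod_cast hn) (hκ n)
  obtain ⟨u, hu, hux⟩ := exists_mem_evolution_of_lipschitz hxL hae
  have hz : Tendsto (fun n => ω (φ n) 0) atTop (𝓝 (x 0)) := hpath' 0 le_rfl (fun _ => 0) (by simp)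
  -- For fixed `i` only finitely many `q` compete: if the limit failed to return at each of them, so
  -- would the paths, eventually for all these `q` at once.
  have hreturn : ∀ i : ℕ, ∃ q ∈ Icc 1 (Q i), dist (x ((q * (i + 1) : ℕ) : ℝ)) (x 0) ≤ r i := by
    intro i
    by_contra! hno
    have hev : ∀ q ∈ Icc 1 (Q i), ∀ᶠ n in atTop,
        r i < dist (ω (φ n) (q * ((i + 1) * ⌈1 / (γ (φ n) : ℝ)⌉₊))) (ω (φ n) 0) := by
      intro q hq
      refine (Tendsto.dist (hpath' _ (Nat.cast_nonneg _) _ ?_) hz).eventually_const_lt (hno q hq)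
      have h1 := (tendsto_mul_ceil_one_div (fun n => hγ0 (φ n))
        (hγlim.comp hφ.tendsto_atTop)).const_mul ((q * (i + 1) : ℕ) : ℝ)
      rw [mul_one] at h1
      refine h1.congr fun n => ?_
      push_cast
      ring
    rw [← (finite_Icc 1 (Q i)).eventually_all] at hev
    obtain ⟨n, hn, hin⟩ := (hev.and (hφ.tendsto_atTop.eventually_ge_atTop i)).exists
    obtain ⟨q, hq, hle⟩ := hret (φ n) i hin
    exact absurd hle (not_le.2 (hn q hq))
  have hlimit : x 0 ∈ limitSet u := by
    refine mem_iInter.2 fun t => Metric.mem_closure_iff.2 fun δ hδ => ?_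
    obtain ⟨i, hi1, hi2⟩ := ((hr.eventually_lt_const hδ).and
      ((tendsto_natCast_atTop_atTop (R := ℝ)).eventually_ge_atTop (t : ℝ))).exists
    obtain ⟨q, hq, hle⟩ := hreturn i
    refine ⟨u (q * (i + 1) : ℕ), mem_image_of_mem _ ?_, ?_⟩
    · rw [mem_Ici, ← NNReal.coe_le_coe]
      refine hi2.trans ?_
      have h1 : i ≤ q * (i + 1) := by nlinarith [hq.1]
      exact_mod_cast h1
    · rw [hux, dist_comm]
      exact lt_of_le_of_lt (by simpa using hle) hi1
  have hBC : x 0 ∈ birkhoffCenter (evolution (meanMap μ H)) :=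
    subset_closure (mem_iUnion₂.2 ⟨u, hu, hlimit⟩)
  have hdist := (Metric.continuous_infEDist (s := birkhoffCenter (evolution (meanMap μ H)))).tendsto
    (x 0) |>.comp hz
  rw [Metric.infEDist_zero_of_mem hBC] at hdist
  obtain ⟨n, hn⟩ := (hdist.eventually_lt_const hε).exists
  exact absurd (hfar (φ n)) (not_le.2 hn)

end Deterministic

/-! ### Markov property on path space -/

section Markov

variable {E : Type*} [MeasurableSpace E] {ν : Measure E} {P : Kernel E E} [IsMarkovKernel P]

lemma map_chainLaw_zero : (chainLaw ν P).map (fun ω => ω 0) = ν := by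
  have h1 : (fun ω : ℕ → E => ω 0) =
      (fun w : (Π _ : Finset.Iic 0, E) => w ⟨0, Finset.mem_Iic.2 le_rfl⟩) ∘
        Preorder.frestrictLe (π := fun _ => E) 0 := rfl
  have hm : Measurable fun w : (Π _ : Finset.Iic 0, E) => w ⟨0, Finset.mem_Iic.2 le_rfl⟩ :=
    measurable_pi_apply _
  rw [h1, ← Measure.map_map hm (Preorder.measurable_frestrictLe 0), chainLaw,
    Kernel.trajMeasure, Measure.map_comp _ _ (Preorder.measurable_frestrictLe 0),
    Kernel.traj_map_frestrictLe, Kernel.partialTraj_self, Measure.id_comp,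
    Measure.map_map hm (MeasurableEquiv.measurable _)]
  exact Measure.map_id

variable [IsProbabilityMeasure ν]

instance : IsProbabilityMeasure (chainLaw ν P) := by
  unfold chainLaw; infer_instance

/-- The path `ω` frozen at time `n`. -/
def freeze (n : ℕ) (ω : ℕ → E) (i : ℕ) : E := ω (min i n)

/-- The path frozen at time `n`, in terms of its restriction to `[0, n]`. -/
def freezeOfRestrict (n : ℕ) (w : Π _ : Finset.Iic n, E) (i : ℕ) : E :=
  w ⟨min i n, Finset.mem_Iic.2 (min_le_right _ _)⟩

lemma measurable_freezeOfRestrict (n : ℕ) :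
    Measurable (freezeOfRestrict n : (Π _ : Finset.Iic n, E) → ℕ → E) :=
  measurable_pi_lambda _ fun _ => measurable_pi_apply _

/-- The Markov property at time `n`. -/
lemma map_frestrictLe_compProd_chainLaw (n : ℕ) :
    (chainLaw ν P).map (Preorder.frestrictLe (π := fun _ => E) n) ⊗ₘ
        P.comap (fun w : (Π _ : Finset.Iic n, E) => w ⟨n, Finset.mem_Iic.2 le_rfl⟩)
          (measurable_pi_apply _) =
      (chainLaw ν P).map (fun ω => (Preorder.frestrictLe (π := fun _ => E) n ω, ω (n + 1))) :=
  Kernel.map_frestrictLe_trajMeasure_compProd_eq_map_trajMeasure (X := fun _ => E) (a := n)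

/-- Freezing lets a functional of the past be written on full sequences: it depends only on the
coordinates up to `n`, so the conditional law of the next state can be integrated out. -/
lemma lintegral_chainLaw_succ (n : ℕ) {F : (ℕ → E) → E → ℝ≥0∞}
    (hF : Measurable (Function.uncurry F)) :
    ∫⁻ ω, F (freeze n ω) (ω (n + 1)) ∂(chainLaw ν P) =
      ∫⁻ ω, ∫⁻ y, F (freeze n ω) y ∂(P (ω n)) ∂(chainLaw ν P) := by
  have h0 : Measurable (Preorder.frestrictLe (π := fun _ => E) n) :=
    Preorder.measurable_frestrictLe n
  have h1 : Measurable fun ω : ℕ → E => (Preorder.frestrictLe (π := fun _ => E) n ω, ω (n + 1)) :=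
    h0.prodMk (measurable_pi_apply _)
  have hF' : Measurable fun z : (Π _ : Finset.Iic n, E) × E =>
      F (freezeOfRestrict n z.1) z.2 :=
    hF.comp (((measurable_freezeOfRestrict n).comp measurable_fst).prodMk measurable_snd)
  have h2 := lintegral_map (μ := chainLaw ν P) hF' h1
  rw [← map_frestrictLe_compProd_chainLaw, Measure.lintegral_compProd hF',
    lintegral_map hF'.lintegral_kernel_prod_right' h0] at h2
  exact h2.symm

lemma integral_chainLaw_succ (n : ℕ) {F : (ℕ → E) → E → ℝ} {C : ℝ}
    (hF : Measurable (Function.uncurry F)) (hC : ∀ ω y, |F ω y| ≤ C) :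
    ∫ ω, F (freeze n ω) (ω (n + 1)) ∂(chainLaw ν P) =
      ∫ ω, ∫ y, F (freeze n ω) y ∂(P (ω n)) ∂(chainLaw ν P) := by
  have h0 : Measurable (Preorder.frestrictLe (π := fun _ => E) n) :=
    Preorder.measurable_frestrictLe n
  have h1 : Measurable fun ω : ℕ → E => (Preorder.frestrictLe (π := fun _ => E) n ω, ω (n + 1)) :=
    h0.prodMk (measurable_pi_apply _)
  have hF' : Measurable fun z : (Π _ : Finset.Iic n, E) × E =>
      F (freezeOfRestrict n z.1) z.2 :=
    hF.comp (((measurable_freezeOfRestrict n).comp measurable_fst).prodMk measurable_snd)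
  have h2 := integral_map (μ := chainLaw ν P) h1.aemeasurable hF'.aestronglyMeasurable
  have : IsProbabilityMeasure ((chainLaw ν P).map (Preorder.frestrictLe (π := fun _ => E) n)) :=
    Measure.isProbabilityMeasure_map h0.aemeasurable
  rw [← map_frestrictLe_compProd_chainLaw, Measure.integral_compProd, integral_map] at h2
  · exact h2.symm
  · exact h0.aemeasurable
  · exact (hF'.stronglyMeasurable.integral_kernel_prod_right').aestronglyMeasurable
  · exact Integrable.of_bound hF'.aestronglyMeasurable C (ae_of_all _ fun z => hC _ _)

end Markov

/-! ### Summation of the drift inequality -/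

section Drift

variable {E : Type*} [NormedAddCommGroup E] [MeasurableSpace E] {ν : Measure E}
  [IsProbabilityMeasure ν] {γ₀ : ℝ} {P : Ioo (0 : ℝ) γ₀ → Kernel E E} [∀ γ, IsMarkovKernel (P γ)]
  {V ψ : E → ℝ} {α β : Ioo (0 : ℝ) γ₀ → ℝ}

/-- Cumulated form of the Pakes-Has'minskii drift inequality. -/
lemma sum_lintegral_psi_le (hPH : PH P V ψ α β) (γ : Ioo (0 : ℝ) γ₀) (n : ℕ) :
    ∫⁻ ω, ENNReal.ofReal (V (ω n)) ∂(chainLaw ν (P γ)) +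
      ENNReal.ofReal (α γ) * ∑ k ∈ Finset.range n,
        ∫⁻ ω, ENNReal.ofReal (ψ (ω k)) ∂(chainLaw ν (P γ)) ≤
      ∫⁻ x, ENNReal.ofReal (V x) ∂ν + n * ENNReal.ofReal (β γ) := by
  have hV := hPH.measurable_V.ennreal_ofReal
  have hψ : ∀ n, Measurable fun ω : ℕ → E => ENNReal.ofReal (ψ (ω n)) := fun n =>
    hPH.measurable_psi.ennreal_ofReal.comp (measurable_pi_apply n)
  induction n with
  | zero =>
    simp only [Finset.range_zero, Finset.sum_empty, mul_zero, add_zero, Nat.cast_zero, zero_mul]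
    conv_rhs => rw [← map_chainLaw_zero (ν := ν) (P := P γ),
      lintegral_map hV (measurable_pi_apply 0)]
  | succ n ih =>
    have hstep : ∫⁻ ω, ENNReal.ofReal (V (ω (n + 1))) ∂(chainLaw ν (P γ)) +
        ENNReal.ofReal (α γ) * ∫⁻ ω, ENNReal.ofReal (ψ (ω n)) ∂(chainLaw ν (P γ)) ≤
        ∫⁻ ω, ENNReal.ofReal (V (ω n)) ∂(chainLaw ν (P γ)) + ENNReal.ofReal (β γ) := by
      rw [lintegral_chainLaw_succ n (F := fun _ y => ENNReal.ofReal (V y))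
        (hV.comp measurable_snd), ← lintegral_const_mul _ (hψ n),
        ← lintegral_add_right _ ((hψ n).const_mul _)]
      calc _ ≤ ∫⁻ ω, (ENNReal.ofReal (V (ω n)) + ENNReal.ofReal (β γ)) ∂(chainLaw ν (P γ)) := by
            refine lintegral_mono fun ω => ?_
            obtain ⟨hi, hle⟩ := hPH.drift γ (ω n)
            rw [← ofReal_integral_eq_lintegral_ofReal hi (ae_of_all _ hPH.V_nonneg),
              ← ENNReal.ofReal_mul (hPH.alpha_pos γ).le, ← ENNReal.ofReal_add
                (integral_nonneg hPH.V_nonneg)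
                (mul_nonneg (hPH.alpha_pos γ).le (hPH.psi_nonneg _))]
            -- Since `β γ` may be negative, only subadditivity of `ENNReal.ofReal` is available
            -- here.
            refine le_trans (ENNReal.ofReal_le_ofReal ?_) ENNReal.ofReal_add_le
            linarith
        _ = _ := by
            rw [lintegral_add_right _ measurable_const]; simp
    rw [Finset.sum_range_succ, mul_add]
    generalize ∫⁻ ω, ENNReal.ofReal (V (ω (n + 1))) ∂(chainLaw ν (P γ)) = a₁ at *
    generalize ∫⁻ ω, ENNReal.ofReal (V (ω n)) ∂(chainLaw ν (P γ)) = a₀ at *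
    generalize ENNReal.ofReal (α γ) * ∫⁻ ω, ENNReal.ofReal (ψ (ω n)) ∂(chainLaw ν (P γ)) = e at *
    generalize ENNReal.ofReal (α γ) * ∑ k ∈ Finset.range n,
        ∫⁻ ω, ENNReal.ofReal (ψ (ω k)) ∂(chainLaw ν (P γ)) = S at *
    calc a₁ + (S + e) = (a₁ + e) + S := by ring
      _ ≤ (a₀ + ENNReal.ofReal (β γ)) + S := by gcongr
      _ = (a₀ + S) + ENNReal.ofReal (β γ) := by ring
      _ ≤ (∫⁻ x, ENNReal.ofReal (V x) ∂ν + n * ENNReal.ofReal (β γ)) + ENNReal.ofReal (β γ) := by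
        gcongr
      _ = _ := by push_cast; ring

end Drift

/-! ### A maximal inequality for bounded orthogonal increments -/

section Martingale

variable {Ω E : Type*} [MeasurableSpace Ω] {m : Measure Ω} [IsProbabilityMeasure m]
  [NormedAddCommGroup E] [InnerProductSpace ℝ E]

/-- Sums of bounded orthogonal increments: bound of the second moment. -/
lemma integral_sq_norm_sum_le {d : ℕ → Ω → E} {a : ℝ}
    (hd : ∀ l, StronglyMeasurable (d l)) (ha : ∀ l z, ‖d l z‖ ≤ a)
    (horth : ∀ k, ∫ z, inner ℝ (∑ l ∈ Finset.range k, d l z) (d k z) ∂m = 0) (k : ℕ) :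
    Integrable (fun z => ‖∑ l ∈ Finset.range k, d l z‖ ^ 2) m ∧
      ∫ z, ‖∑ l ∈ Finset.range k, d l z‖ ^ 2 ∂m ≤ k * a ^ 2 := by
  have hS : ∀ k, StronglyMeasurable fun z => ∑ l ∈ Finset.range k, d l z := fun k =>
    Finset.stronglyMeasurable_fun_sum _ fun l _ => hd l
  have hSb : ∀ k z, ‖∑ l ∈ Finset.range k, d l z‖ ≤ k * a := fun k z =>
    (norm_sum_le_of_le _ fun l _ => ha l z).trans_eq (by simp)
  have hint : ∀ k, Integrable (fun z => ‖∑ l ∈ Finset.range k, d l z‖ ^ 2) m := fun k => by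
    refine Integrable.of_bound ((hS k).norm.pow 2).aestronglyMeasurable ((k * a) ^ 2)
      (ae_of_all _ fun z => ?_)
    rw [Real.norm_of_nonneg (by positivity)]
    exact pow_le_pow_left₀ (norm_nonneg _) (hSb k z) 2
  refine ⟨hint k, ?_⟩
  induction k with
  | zero => simp
  | succ k ih =>
    have h1 : Integrable (fun z => 2 * inner ℝ (∑ l ∈ Finset.range k, d l z) (d k z)) m := by
      refine (Integrable.of_bound ((hS k).inner (hd k)).aestronglyMeasurable ((k * a) * a)
        (ae_of_all _ fun z => ?_)).const_mul 2
      refine (norm_inner_le_norm _ _).trans ?_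
      have := hSb k z
      have := ha k z
      gcongr
      exact (norm_nonneg _).trans (hSb k z)
    have h2 : Integrable (fun z => ‖d k z‖ ^ 2) m := by
      refine Integrable.of_bound ((hd k).norm.pow 2).aestronglyMeasurable (a ^ 2)
        (ae_of_all _ fun z => ?_)
      rw [Real.norm_of_nonneg (by positivity)]
      exact pow_le_pow_left₀ (norm_nonneg _) (ha k z) 2
    simp_rw [Finset.sum_range_succ, norm_add_sq_real]
    have h12 : Integrable (fun z => ‖∑ l ∈ Finset.range k, d l z‖ ^ 2 +
        2 * inner ℝ (∑ l ∈ Finset.range k, d l z) (d k z)) m := (hint k).add h1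
    rw [integral_add h12 h2, integral_add (hint k) h1, integral_const_mul, horth k]
    have h3 : ∫ z, ‖d k z‖ ^ 2 ∂m ≤ a ^ 2 := by
      calc ∫ z, ‖d k z‖ ^ 2 ∂m ≤ ∫ _, a ^ 2 ∂m :=
            integral_mono h2 (integrable_const _) fun z =>
              pow_le_pow_left₀ (norm_nonneg _) (ha k z) 2
        _ = a ^ 2 := by simp
    push_cast
    linarith

/-- Maximal inequality for sums of bounded orthogonal increments, by subdivision into blocks of
length `L`. -/
lemma measure_exists_norm_sum_gt_le {d : ℕ → Ω → E} {a : ℝ}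
    (hd : ∀ l, StronglyMeasurable (d l)) (ha : ∀ l z, ‖d l z‖ ≤ a)
    (horth : ∀ k, ∫ z, inner ℝ (∑ l ∈ Finset.range k, d l z) (d k z) ∂m = 0) {n L : ℕ}
    (hL : 0 < L) {c : ℝ} (hc : 0 < c) (haL : L * a ≤ c) :
    m {z | ∃ k ≤ n, 2 * c < ‖∑ l ∈ Finset.range k, d l z‖} ≤
      ENNReal.ofReal (((n : ℝ) / L + 1) * (n * a ^ 2 / c ^ 2)) := by
  have hone : ∀ k ≤ n, m {z | c ≤ ‖∑ l ∈ Finset.range k, d l z‖} ≤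
      ENNReal.ofReal (n * a ^ 2 / c ^ 2) := by
    intro k hk
    obtain ⟨hi, hle⟩ := integral_sq_norm_sum_le hd ha horth k
    have h1 := mul_meas_ge_le_integral_of_nonneg (ae_of_all m fun z => sq_nonneg _) hi (c ^ 2)
    have h2 : {z | c ≤ ‖∑ l ∈ Finset.range k, d l z‖} ⊆
        {z | c ^ 2 ≤ ‖∑ l ∈ Finset.range k, d l z‖ ^ 2} := fun z hz =>
      pow_le_pow_left₀ hc.le hz 2
    refine (measure_mono h2).trans ?_
    rw [← ofReal_measureReal]
    refine ENNReal.ofReal_le_ofReal ?_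
    rw [le_div_iff₀ (by positivity), mul_comm]
    refine h1.trans (hle.trans ?_)
    gcongr
  -- Fewer than `L` increments separate `k` from the preceding multiple of `L`, and they add up to
  -- at most `L * a ≤ c`. The partial sum at that multiple is thus at least `c`; there are `n / L +
  -- 1` candidates, each handled by Chebyshev.
  have hsub : {z | ∃ k ≤ n, 2 * c < ‖∑ l ∈ Finset.range k, d l z‖} ⊆
      ⋃ p ∈ Finset.range (n / L + 1), {z | c ≤ ‖∑ l ∈ Finset.range (L * p), d l z‖} := by
    rintro z ⟨k, hk, hz⟩
    simp only [mem_iUnion, Finset.mem_range]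
    refine ⟨k / L, Nat.lt_succ_of_le (Nat.div_le_div_right hk), ?_⟩
    have h1 : ∑ l ∈ Finset.range k, d l z = ∑ l ∈ Finset.range (L * (k / L)), d l z +
        ∑ l ∈ Finset.range (k % L), d (L * (k / L) + l) z := by
      rw [← Finset.sum_range_add, Nat.div_add_mod]
    have ha0 : 0 ≤ a := (norm_nonneg _).trans (ha 0 z)
    have h2 : ‖∑ l ∈ Finset.range (k % L), d (L * (k / L) + l) z‖ ≤ c := by
      refine (norm_sum_le_of_le _ fun l _ => ha _ z).trans ?_
      rw [Finset.sum_const, Finset.card_range, nsmul_eq_mul]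
      refine le_trans ?_ haL
      gcongr
      exact (Nat.mod_lt _ hL).le
    have h3 := norm_add_le (∑ l ∈ Finset.range (L * (k / L)), d l z)
      (∑ l ∈ Finset.range (k % L), d (L * (k / L) + l) z)
    rw [← h1] at h3
    show c ≤ _
    linarith
  refine (measure_mono hsub).trans ((measure_biUnion_finset_le _ _).trans ?_)
  calc ∑ p ∈ Finset.range (n / L + 1), m {z | c ≤ ‖∑ l ∈ Finset.range (L * p), d l z‖}
      ≤ ∑ p ∈ Finset.range (n / L + 1), ENNReal.ofReal (n * a ^ 2 / c ^ 2) := by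
        refine Finset.sum_le_sum fun p hp => hone _ ?_
        have : p ≤ n / L := Nat.lt_succ_iff.1 (Finset.mem_range.1 hp)
        calc L * p ≤ L * (n / L) := Nat.mul_le_mul_left _ this
          _ ≤ n := Nat.mul_div_le n L
    _ = ENNReal.ofReal (((n / L : ℕ) + 1 : ℝ) * (n * a ^ 2 / c ^ 2)) := by
        rw [Finset.sum_const, Finset.card_range, nsmul_eq_mul, ENNReal.ofReal_mul (by positivity)]
        congr 1
        rw [← Nat.cast_add_one, ENNReal.ofReal_natCast]
    _ ≤ _ := by
        refine ENNReal.ofReal_le_ofReal ?_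
        gcongr
        exact Nat.cast_div_le

end Martingale

/-! ### Truncation of the increments -/

section Truncation

variable {E : Type*} [NormedAddCommGroup E]

/-- The truncation of vectors at norm `A`. -/
noncomputable def truncate (A : ℝ) (v : E) : E :=
  open Classical in if ‖v‖ ≤ A then v else 0

lemma norm_truncate_le {A : ℝ} (hA : 0 ≤ A) (v : E) : ‖truncate A v‖ ≤ A := by
  unfold truncate
  split_ifs with h
  · exact h
  · simpa using hA

/-- Where `‖v‖ > A`, write `‖v‖ = ‖v‖ ^ (-ε) * ‖v‖ ^ (1 + ε)` and bound the first factor by `A ^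
(-ε)`. -/
lemma enorm_sub_truncate_le {A ε : ℝ} (hA : 0 < A) (hε : 0 < ε) (v : E) :
    ‖v - truncate A v‖ₑ ≤ ENNReal.ofReal (A ^ (-ε)) * ‖v‖ₑ ^ (1 + ε) := by
  unfold truncate
  split_ifs with h
  · simp
  · have hv : 0 < ‖v‖ := hA.trans (not_le.1 h)
    rw [sub_zero, ← ofReal_norm, ENNReal.ofReal_rpow_of_pos hv, ← ENNReal.ofReal_mul (by positivity)]
    refine ENNReal.ofReal_le_ofReal ?_
    calc ‖v‖ = ‖v‖ ^ (-ε) * ‖v‖ ^ (1 + ε) := by rw [← Real.rpow_add hv]; norm_num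
      _ ≤ A ^ (-ε) * ‖v‖ ^ (1 + ε) := by
        have h1 : -ε ≤ 0 := by linarith
        exact mul_le_mul_of_nonneg_right
          (Real.rpow_le_rpow_of_nonpos hA (not_le.1 h).le h1) (by positivity)

variable [MeasurableSpace E]

lemma measurable_truncate [BorelSpace E] (A : ℝ) : Measurable (truncate A : E → E) :=
  Measurable.ite (measurableSet_le measurable_norm measurable_const) measurable_id
    measurable_const

variable [NormedSpace ℝ E]

/-- Centering at most doubles the `L^1` norm of the tail. -/
lemma lintegral_enorm_sub_truncate_le [BorelSpace E] {Ω : Type*} [MeasurableSpace Ω] {m : Measure Ω}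
    [IsProbabilityMeasure m] {A ε : ℝ} (hA : 0 < A) (hε : 0 < ε) {u : Ω → E} {C : ℝ≥0∞}
    (hu : Measurable u) (hC : ∫⁻ z, ‖u z‖ₑ ^ (1 + ε) ∂m ≤ C) :
    ∫⁻ z, ‖(u z - truncate A (u z)) - ∫ z', (u z' - truncate A (u z')) ∂m‖ₑ ∂m ≤
      2 * (ENNReal.ofReal (A ^ (-ε)) * C) := by
  have h1 : ∫⁻ z, ‖u z - truncate A (u z)‖ₑ ∂m ≤ ENNReal.ofReal (A ^ (-ε)) * C := by
    calc ∫⁻ z, ‖u z - truncate A (u z)‖ₑ ∂m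
        ≤ ∫⁻ z, ENNReal.ofReal (A ^ (-ε)) * ‖u z‖ₑ ^ (1 + ε) ∂m :=
          lintegral_mono fun z => enorm_sub_truncate_le hA hε _
      _ = ENNReal.ofReal (A ^ (-ε)) * ∫⁻ z, ‖u z‖ₑ ^ (1 + ε) ∂m :=
          lintegral_const_mul _ (hu.enorm.pow_const _)
      _ ≤ _ := by gcongr
  calc _ ≤ ∫⁻ z, (‖u z - truncate A (u z)‖ₑ + ‖∫ z', (u z' - truncate A (u z')) ∂m‖ₑ) ∂m :=
        lintegral_mono fun z => enorm_sub_le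
    _ = ∫⁻ z, ‖u z - truncate A (u z)‖ₑ ∂m + ‖∫ z', (u z' - truncate A (u z')) ∂m‖ₑ := by
        rw [lintegral_add_right _ measurable_const]; simp
    _ ≤ ∫⁻ z, ‖u z - truncate A (u z)‖ₑ ∂m + ∫⁻ z, ‖u z - truncate A (u z)‖ₑ ∂m := by
        gcongr
        exact enorm_integral_le_lintegral_enorm _
    _ ≤ _ := by rw [two_mul]; gcongr

/-- The centered truncated step of a Markov chain with kernel `Q`, ignored outside of the ball of
radius `R`. -/
noncomputable def truncStep (Q : Kernel E E) (γ R A : ℝ) (x y : E) : E :=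
  open Classical in if ‖x‖ ≤ R then
    γ • (truncate A (γ⁻¹ • (y - x)) - ∫ z, truncate A (γ⁻¹ • (z - x)) ∂(Q x)) else 0

variable {Q : Kernel E E} [IsMarkovKernel Q]

lemma norm_truncStep_le {γ R A : ℝ} (hγ : 0 ≤ γ) (hA : 0 ≤ A) (x y : E) :
    ‖truncStep Q γ R A x y‖ ≤ 2 * A * γ := by
  unfold truncStep
  split_ifs with h
  · rw [norm_smul, Real.norm_of_nonneg hγ, mul_comm (2 * A)]
    refine mul_le_mul_of_nonneg_left ((norm_sub_le _ _).trans ?_) hγ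
    have h1 : ‖∫ z, truncate A (γ⁻¹ • (z - x)) ∂(Q x)‖ ≤ A := by
      simpa using norm_integral_le_of_norm_le_const (μ := Q x)
        (ae_of_all _ fun z => norm_truncate_le hA (γ⁻¹ • (z - x)))
    linarith [norm_truncate_le hA (γ⁻¹ • (y - x))]
  · simp only [norm_zero]; positivity

lemma measurable_truncStep [BorelSpace E] [SecondCountableTopology E] (γ R A : ℝ) :
    Measurable fun z : E × E => truncStep Q γ R A z.1 z.2 := by
  have h1 : Measurable fun z : E × E => truncate A (γ⁻¹ • (z.2 - z.1)) :=
    (measurable_truncate A).comp ((measurable_snd.sub measurable_fst).const_smul _)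
  have h2 : Measurable fun x : E => ∫ z, truncate A (γ⁻¹ • (z - x)) ∂(Q x) :=
    (h1.stronglyMeasurable.integral_kernel_prod_right' (κ := Q)).measurable
  exact Measurable.ite (measurableSet_le measurable_fst.norm measurable_const)
    ((h1.sub (h2.comp measurable_fst)).const_smul γ) measurable_const

end Truncation

/-! ### Smallness of the noise in probability -/

section NoiseBound

variable {Ξ E : Type*} [MeasurableSpace Ξ] [NormedAddCommGroup E] [InnerProductSpace ℝ E]
  [FiniteDimensional ℝ E] [MeasurableSpace E] [BorelSpace E] {μ : Measure Ξ}
  {γ₀ : ℝ} {P : Ioo (0 : ℝ) γ₀ → Kernel E E} [∀ γ, IsMarkovKernel (P γ)]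
  {h : Ioo (0 : ℝ) γ₀ → Ξ → E → E} {H : Ξ → E → Set E}

lemma integral_inner_truncStep (Q : Kernel E E) [IsMarkovKernel Q] {γ R A : ℝ} (hA : 0 ≤ A)
    (v x : E) : ∫ y, inner ℝ v (truncStep Q γ R A x y) ∂(Q x) = 0 := by
  have : ProperSpace E := FiniteDimensional.proper ℝ E
  have : CompleteSpace E := FiniteDimensional.complete ℝ E
  have hi : Integrable (fun y => truncate A (γ⁻¹ • (y - x))) (Q x) :=
    Integrable.of_bound ((measurable_truncate A).comp
      ((measurable_id.sub_const x).const_smul _)).aestronglyMeasurable A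
      (ae_of_all _ fun y => norm_truncate_le hA _)
  unfold truncStep
  split_ifs with h
  · have hi' : Integrable (fun y => γ • (truncate A (γ⁻¹ • (y - x)) -
        ∫ z, truncate A (γ⁻¹ • (z - x)) ∂(Q x))) (Q x) := (hi.sub (integrable_const _)).smul γ
    rw [integral_inner hi', integral_smul, integral_sub hi (integrable_const _)]
    simp
  · simp

/-- The sum depends only on coordinates up to `j + k`, and the next centered step has mean zero
given them. The offset `j` allows windows starting at any time without shifting the law. -/
lemma integral_inner_sum_truncStep (Q : Kernel E E) [IsMarkovKernel Q] (ν : Measure E)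
    [IsProbabilityMeasure ν] {γ R A : ℝ} (hγ : 0 ≤ γ) (hA : 0 ≤ A) (j k : ℕ) :
    ∫ ω, inner ℝ (∑ l ∈ Finset.range k, truncStep Q γ R A (ω (j + l)) (ω (j + l + 1)))
      (truncStep Q γ R A (ω (j + k)) (ω (j + k + 1))) ∂(chainLaw ν Q) = 0 := by
  have : ProperSpace E := FiniteDimensional.proper ℝ E
  set F : (ℕ → E) → E → ℝ := fun ω y =>
    inner ℝ (∑ l ∈ Finset.range k, truncStep Q γ R A (ω (j + l)) (ω (j + l + 1)))
      (truncStep Q γ R A (ω (j + k)) y)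
  have hF : Measurable (Function.uncurry F) := by
    refine Measurable.inner (Finset.measurable_fun_sum _ fun l _ => ?_) ?_
    · exact (measurable_truncStep γ R A).comp
        (((measurable_pi_apply (j + l)).comp measurable_fst).prodMk
        ((measurable_pi_apply (j + l + 1)).comp measurable_fst))
    · exact (measurable_truncStep γ R A).comp
        (((measurable_pi_apply (j + k)).comp measurable_fst).prodMk measurable_snd)
  have hb : ∀ ω y, |F ω y| ≤ (k * (2 * A * γ)) * (2 * A * γ) := by
    intro ω y
    refine (abs_real_inner_le_norm _ _).trans ?_
    gcongr
    · refine (norm_sum_le_of_le _ fun l _ => norm_truncStep_le hγ hA _ _).trans_eq (by simp)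
    · exact norm_truncStep_le hγ hA _ _
  have hfr : ∀ ω y, F (freeze (j + k) ω) y = F ω y := by
    intro ω y
    simp only [F, freeze, min_self]
    congr 1
    refine Finset.sum_congr rfl fun l hl => ?_
    have := Finset.mem_range.1 hl
    rw [min_eq_left (by omega), min_eq_left (by omega)]
  have h1 := integral_chainLaw_succ (ν := ν) (P := Q) (j + k) hF hb
  simp only [hfr] at h1
  refine h1.trans ?_
  simp only [F, integral_inner_truncStep Q hA, integral_zero]

lemma measurable_noiseStep {b : E → E} (hb : Measurable b) (γ R : ℝ) :
    Measurable fun z : E × E => noiseStep b γ R z.1 z.2 := by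
  have : ProperSpace E := FiniteDimensional.proper ℝ E
  exact Measurable.ite (measurableSet_le measurable_fst.norm measurable_const)
    ((measurable_snd.sub measurable_fst).sub ((hb.comp measurable_fst).const_smul γ))
    measurable_const

/-- By the drift identity, `γ` times the mean field is the mean of the step; so the difference is
`γ` times the centered tail of the rescaled step. -/
lemma lintegral_noiseStep_sub_truncStep_le (hRM : RM P μ h H) {R A ε : ℝ} {C : ℝ≥0}
    (hA : 0 < A) (hε : 0 < ε)
    (hC : ∀ x ∈ Metric.closedBall (0 : E) R, ∀ γ : Ioo (0 : ℝ) γ₀,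
      ∫⁻ y, ‖(γ : ℝ)⁻¹ • (y - x)‖ₑ ^ (1 + ε) ∂(P γ x) ≤ C) (γ : Ioo (0 : ℝ) γ₀) (x : E) :
    ∫⁻ y, ‖noiseStep (meanField μ h γ) γ R x y - truncStep (P γ) γ R A x y‖ₑ ∂(P γ x) ≤
      ENNReal.ofReal (γ * (2 * (A ^ (-ε) * C))) := by
  have : ProperSpace E := FiniteDimensional.proper ℝ E
  have hγ : 0 < (γ : ℝ) := γ.2.1
  by_cases hx : ‖x‖ ≤ R
  · have hum : Measurable fun y : E => (γ : ℝ)⁻¹ • (y - x) :=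
      (measurable_id.sub_const x).const_smul _
    have hCx := hC x (by simpa using hx) γ
    have hui : Integrable (fun y => (γ : ℝ)⁻¹ • (y - x)) (P γ x) :=
      integrable_of_integrable_rpow (by linarith : 1 < 1 + ε) hum.aestronglyMeasurable
        (integrable_rpow_of_lintegral_le (by linarith) (by simp) hum.aestronglyMeasurable hCx).1
    have hti : Integrable (fun y => truncate A ((γ : ℝ)⁻¹ • (y - x))) (P γ x) :=
      Integrable.of_bound ((measurable_truncate A).comp hum).aestronglyMeasurable A
        (ae_of_all _ fun y => norm_truncate_le hA.le _)
    have heq : ∀ y, noiseStep (meanField μ h γ) γ R x y - truncStep (P γ) γ R A x y =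
        (γ : ℝ) • (((γ : ℝ)⁻¹ • (y - x) - truncate A ((γ : ℝ)⁻¹ • (y - x))) -
          ∫ z, ((γ : ℝ)⁻¹ • (z - x) - truncate A ((γ : ℝ)⁻¹ • (z - x))) ∂(P γ x)) := by
      intro y
      have hd : meanField μ h γ x = ∫ z, (γ : ℝ)⁻¹ • (z - x) ∂(P γ x) := (hRM.drift γ x).symm
      have hyx : y - x = (γ : ℝ) • ((γ : ℝ)⁻¹ • (y - x)) := (smul_inv_smul₀ hγ.ne' _).symm
      rw [noiseStep, truncStep, if_pos hx, if_pos hx, integral_sub hui hti, ← hd]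
      nth_rewrite 1 [hyx]
      generalize (γ : ℝ)⁻¹ • (y - x) = U
      module
    simp_rw [heq, enorm_smul]
    have hm : Measurable fun y => ‖((γ : ℝ)⁻¹ • (y - x) - truncate A ((γ : ℝ)⁻¹ • (y - x))) -
          ∫ z, ((γ : ℝ)⁻¹ • (z - x) - truncate A ((γ : ℝ)⁻¹ • (z - x))) ∂(P γ x)‖ₑ :=
      ((hum.sub ((measurable_truncate A).comp hum)).sub_const _).enorm
    rw [lintegral_const_mul _ hm, ENNReal.ofReal_mul hγ.le, ENNReal.ofReal_mul zero_le_two,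
      ENNReal.ofReal_mul (by positivity), ENNReal.ofReal_coe_nnreal,
      Real.enorm_of_nonneg hγ.le, ENNReal.ofReal_ofNat]
    gcongr
    exact lintegral_enorm_sub_truncate_le hA hε hum hCx
  · simp [noiseStep, truncStep, hx]

variable [IsProbabilityMeasure μ]

/-- The probability that the noise accumulated on a time interval of length `T` is not small
vanishes as the step size goes to `0`, uniformly in the initial law and the initial time. -/
theorem exists_measure_not_noiseSmall_le (hRM : RM P μ h H) (R : ℝ) {T ρ δ : ℝ} (hT : 0 < T)
    (hρ : 0 < ρ) (hδ : 0 < δ) :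
    ∃ γ₁ : ℝ, 0 < γ₁ ∧ ∀ γ : Ioo (0 : ℝ) γ₀, (γ : ℝ) < γ₁ → ∀ (ν : Measure E)
      [IsProbabilityMeasure ν] (j : ℕ), chainLaw ν (P γ)
        {ω | ¬ NoiseSmall (meanField μ h γ) γ R T ρ fun l => ω (j + l)} ≤ ENNReal.ofReal δ := by
  have : ProperSpace E := FiniteDimensional.proper ℝ E
  obtain ⟨ε, hε, C, hC⟩ := hRM.moment _ (isCompact_closedBall (0 : E) R)
  -- Over at most `T / γ` steps the remainders have total expected norm at most `2 T C A ^ (-ε)`,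
  -- whatever `γ`; Markov's inequality at level `ρ / 2` then costs `δ / 2`.
  obtain ⟨A, hA, hAδ⟩ : ∃ A : ℝ, 0 < A ∧ 2 * T * C * A ^ (-ε) ≤ ρ / 2 * (δ / 2) := by
    have h1 : Tendsto (fun A : ℝ => 2 * T * C * A ^ (-ε)) atTop (𝓝 (2 * T * C * 0)) :=
      (tendsto_rpow_neg_atTop hε).const_mul _
    rw [mul_zero] at h1
    exact ((eventually_gt_atTop 0).and
      (h1.eventually_le_const (by positivity : 0 < ρ / 2 * (δ / 2)))).exists
  set c := ρ / 4
  have hc : 0 < c := by positivity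
  -- The maximal inequality with increments `2 * A * γ` and blocks of length `⌊c / (2 * A * γ)⌋₊`
  -- gives the bound `B * γ`. The first entry of the minimum below makes blocks nonempty, the second
  -- makes `B * γ ≤ δ / 2`.
  set B := (4 * A * T / c + 1) * (4 * A ^ 2 * T / c ^ 2)
  have hB : 0 < B := by positivity
  refine ⟨min (c / (2 * A)) (δ / 2 / B), by positivity, fun γ hγ ν _ j => ?_⟩
  have hγ0 : 0 < (γ : ℝ) := γ.2.1
  have hγ1 : 2 * A * γ ≤ c := by
    have := hγ.le.trans (min_le_left _ _)
    rwa [le_div_iff₀ (by positivity), mul_comm] at this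
  have hγ2 : B * γ ≤ δ / 2 := by
    have := hγ.le.trans (min_le_right _ _)
    rwa [le_div_iff₀ hB, mul_comm] at this
  set n := ⌊T / γ⌋₊
  have hn : (n : ℝ) * γ ≤ T := by
    have := mul_floor_div_le hγ0 hT.le
    linarith
  set d₁ : ℕ → (ℕ → E) → E := fun l ω => truncStep (P γ) γ R A (ω (j + l)) (ω (j + l + 1))
  set d₂ : ℕ → (ℕ → E) → E := fun l ω => noiseStep (meanField μ h γ) γ R (ω (j + l))
    (ω (j + l + 1)) - truncStep (P γ) γ R A (ω (j + l)) (ω (j + l + 1))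
  have hpair : ∀ l, Measurable fun ω : ℕ → E => (ω (j + l), ω (j + l + 1)) := fun l =>
    (measurable_pi_apply _).prodMk (measurable_pi_apply _)
  have hd₂' : Measurable fun z : E × E => noiseStep (meanField μ h γ) γ R z.1 z.2 -
      truncStep (P γ) γ R A z.1 z.2 :=
    (measurable_noiseStep (measurable_meanField hRM γ) γ R).sub (measurable_truncStep γ R A)
  have hd₂ : ∀ l, Measurable (d₂ l) := fun l => hd₂'.comp (hpair l)
  have hsub : {ω : ℕ → E | ¬ NoiseSmall (meanField μ h γ) γ R T ρ fun l => ω (j + l)} ⊆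
      {ω | ∃ k ≤ n, 2 * c < ‖∑ l ∈ Finset.range k, d₁ l ω‖} ∪
      {ω | ENNReal.ofReal (ρ / 2) ≤ ∑ l ∈ Finset.range n, ‖d₂ l ω‖ₑ} := by
    intro ω hω
    simp only [NoiseSmall, mem_ofPred_eq, not_forall, not_le] at hω
    obtain ⟨k, hk, hlt⟩ := hω
    have hkn : k ≤ n := Nat.le_floor (by rw [le_div_iff₀ hγ0]; linarith)
    by_contra hno
    simp only [mem_union, mem_ofPred_eq, not_or, not_exists, not_and, not_lt, not_le] at hno
    obtain ⟨h1, h2⟩ := hno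
    have h3 : ∑ l ∈ Finset.range n, ‖d₂ l ω‖ < ρ / 2 := by
      have : ∑ l ∈ Finset.range n, ‖d₂ l ω‖ₑ =
          ENNReal.ofReal (∑ l ∈ Finset.range n, ‖d₂ l ω‖) := by
        rw [ENNReal.ofReal_sum_of_nonneg fun _ _ => norm_nonneg _]
        simp only [ofReal_norm]
      rw [this] at h2
      exact (ENNReal.ofReal_lt_ofReal_iff (by positivity)).1 h2
    have h4 : noiseSum (meanField μ h γ) γ R (fun l => ω (j + l)) k =
        ∑ l ∈ Finset.range k, d₁ l ω + ∑ l ∈ Finset.range k, d₂ l ω := by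
      rw [← Finset.sum_add_distrib]
      refine Finset.sum_congr rfl fun l _ => ?_
      simp only [d₁, d₂, add_sub_cancel, add_assoc]
    have h5 : ‖∑ l ∈ Finset.range k, d₂ l ω‖ ≤ ∑ l ∈ Finset.range n, ‖d₂ l ω‖ :=
      (norm_sum_le _ _).trans (Finset.sum_le_sum_of_subset_of_nonneg
        (Finset.range_subset_range.2 hkn) fun _ _ _ => norm_nonneg _)
    have h6 := norm_add_le (∑ l ∈ Finset.range k, d₁ l ω) (∑ l ∈ Finset.range k, d₂ l ω)
    rw [h4] at hlt
    have h7 := h1 k hkn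
    simp only [c] at h7
    linarith
  have hfirst : chainLaw ν (P γ) {ω | ∃ k ≤ n, 2 * c < ‖∑ l ∈ Finset.range k, d₁ l ω‖} ≤
      ENNReal.ofReal (δ / 2) := by
    have ha0 : 0 < 2 * A * γ := by positivity
    have hone : 1 ≤ c / (2 * A * γ) := by rwa [one_le_div ha0]
    have hL : 0 < ⌊c / (2 * A * γ)⌋₊ := Nat.floor_pos.2 hone
    have hL1 : (1 : ℝ) ≤ ⌊c / (2 * A * γ)⌋₊ := by exact_mod_cast hL
    have hLa : (⌊c / (2 * A * γ)⌋₊ : ℝ) * (2 * A * γ) ≤ c := by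
      have := mul_floor_div_le ha0 hc.le
      linarith
    -- As the floor is at least `1`, rounding down loses at most a factor `2`.
    have hLc : c ≤ 2 * (2 * A * γ) * ⌊c / (2 * A * γ)⌋₊ := by
      have h1 := lt_mul_floor_div_add (u := c) ha0
      nlinarith
    refine (measure_exists_norm_sum_gt_le
      (fun l => ((measurable_truncStep γ R A).comp (hpair l)).stronglyMeasurable)
      (fun l ω => norm_truncStep_le hγ0.le hA.le _ _)
      (integral_inner_sum_truncStep (P γ) ν hγ0.le hA.le j) hL hc hLa).trans ?_
    refine ENNReal.ofReal_le_ofReal (le_trans ?_ hγ2)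
    have h1 : (n : ℝ) / ⌊c / (2 * A * γ)⌋₊ ≤ 4 * A * T / c := by
      rw [div_le_div_iff₀ (by positivity) hc]
      calc (n : ℝ) * c ≤ n * (2 * (2 * A * γ) * ⌊c / (2 * A * γ)⌋₊) := by gcongr
        _ = 4 * A * (n * γ) * ⌊c / (2 * A * γ)⌋₊ := by ring
        _ ≤ 4 * A * T * ⌊c / (2 * A * γ)⌋₊ := by gcongr
    have h2 : (n : ℝ) * (2 * A * γ) ^ 2 / c ^ 2 ≤ 4 * A ^ 2 * T / c ^ 2 * γ := by
      rw [div_mul_eq_mul_div]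
      refine div_le_div_of_nonneg_right ?_ (by positivity)
      calc (n : ℝ) * (2 * A * γ) ^ 2 = 4 * A ^ 2 * (n * γ) * γ := by ring
        _ ≤ 4 * A ^ 2 * T * γ := by gcongr
    calc _ ≤ (4 * A * T / c + 1) * (4 * A ^ 2 * T / c ^ 2 * γ) := by gcongr
      _ = B * γ := by simp only [B]; ring
  have hsecond : chainLaw ν (P γ)
      {ω | ENNReal.ofReal (ρ / 2) ≤ ∑ l ∈ Finset.range n, ‖d₂ l ω‖ₑ} ≤ ENNReal.ofReal (δ / 2) := by
    have hρ0 : ENNReal.ofReal (ρ / 2) ≠ 0 := by simpa using half_pos hρ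
    have h1 := mul_meas_ge_le_lintegral (μ := chainLaw ν (P γ))
      (Finset.measurable_fun_sum (Finset.range n) fun l _ => (hd₂ l).enorm) (ENNReal.ofReal (ρ / 2))
    rw [lintegral_finsetSum _ fun l _ => (hd₂ l).enorm] at h1
    have h2 : ∀ l, ∫⁻ ω, ‖d₂ l ω‖ₑ ∂(chainLaw ν (P γ)) ≤
        ENNReal.ofReal (γ * (2 * (A ^ (-ε) * C))) := by
      intro l
      have hpair' : Measurable fun z : (ℕ → E) × E => (z.1 (j + l), z.2) :=
        ((measurable_pi_apply (j + l)).comp measurable_fst).prodMk measurable_snd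
      have hF : Measurable (Function.uncurry fun (ω : ℕ → E) (y : E) =>
          ‖noiseStep (meanField μ h γ) γ R (ω (j + l)) y -
            truncStep (P γ) γ R A (ω (j + l)) y‖ₑ) := (hd₂'.comp hpair').enorm
      have h3 := lintegral_chainLaw_succ (ν := ν) (P := P γ) (j + l) hF
      simp only [freeze, min_self] at h3
      refine h3.trans_le ?_
      calc _ ≤ ∫⁻ _, ENNReal.ofReal (γ * (2 * (A ^ (-ε) * C))) ∂(chainLaw ν (P γ)) :=
            lintegral_mono fun ω => lintegral_noiseStep_sub_truncStep_le hRM hA hε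
              (fun x hx γ => (hC x hx γ).1) γ (ω (j + l))
        _ = _ := by simp
    have h4 := h1.trans (Finset.sum_le_sum fun l _ => h2 l)
    rw [Finset.sum_const, Finset.card_range, nsmul_eq_mul, ← ENNReal.ofReal_natCast,
      ← ENNReal.ofReal_mul (by positivity)] at h4
    rw [← ENNReal.mul_le_mul_iff_right hρ0 ENNReal.ofReal_ne_top,
      ← ENNReal.ofReal_mul (by positivity)]
    refine h4.trans (ENNReal.ofReal_le_ofReal (le_trans ?_ hAδ))
    calc (n : ℝ) * (γ * (2 * (A ^ (-ε) * C))) = (n * γ) * (2 * (A ^ (-ε) * C)) := by ring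
      _ ≤ T * (2 * (A ^ (-ε) * C)) := by gcongr
      _ = _ := by ring
  calc _ ≤ _ := measure_mono hsub
    _ ≤ _ := measure_union_le _ _
    _ ≤ ENNReal.ofReal (δ / 2) + ENNReal.ofReal (δ / 2) := add_le_add hfirst hsecond
    _ = ENNReal.ofReal δ := by
      rw [← ENNReal.ofReal_add (by positivity) (by positivity), add_halves]

end NoiseBound

/-! ### Counting visits without return -/

section Counting

/-- A sequence of times visits a set at most a proportion `1 / (Q + 1)` of the time without
returning to it at one of the `Q` next multiples of `s`. -/
lemma card_visit_without_return_le (A : ℕ → Prop) [DecidablePred A] (Q s n : ℕ) :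
    (Q + 1) * {k ∈ Finset.range n | A k ∧ ∀ q ∈ Finset.Icc 1 Q, ¬ A (k + q * s)}.card ≤
      n + Q * s := by
  set S := {k ∈ Finset.range n | A k ∧ ∀ q ∈ Finset.Icc 1 Q, ¬ A (k + q * s)}
  -- A coincidence would make `k` a return of `k'` after `q' - q` lags. So the `Q + 1` translates of
  -- `S` are disjoint, and all lie below `n + Q * s`.
  have hlt : ∀ q q' k k', q < q' → q' ≤ Q → k ∈ S → k' ∈ S → k + q * s ≠ k' + q' * s := by
    intro q q' k k' hq hq' hk hk' heq
    have h1 := (Finset.mem_filter.1 hk).2.1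
    have h2 := (Finset.mem_filter.1 hk').2.2 (q' - q) (Finset.mem_Icc.2 ⟨by omega, by omega⟩)
    refine h2 ?_
    have h3 : k = k' + (q' - q) * s := by
      obtain ⟨e, rfl⟩ := Nat.exists_eq_add_of_lt hq
      have : q + e + 1 - q = e + 1 := by omega
      rw [this]
      nlinarith
    rwa [← h3]
  have hinj : ∀ z ∈ Finset.range (Q + 1) ×ˢ S, ∀ z' ∈ Finset.range (Q + 1) ×ˢ S,
      z.2 + z.1 * s = z'.2 + z'.1 * s → z = z' := by
    rintro ⟨q, k⟩ hz ⟨q', k'⟩ hz' heq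
    simp only [Finset.mem_product, Finset.mem_range] at hz hz' heq
    rcases lt_trichotomy q q' with h | h | h
    · exact absurd heq (hlt q q' k k' h (by omega) hz.2 hz'.2)
    · subst h
      simpa using heq
    · exact absurd heq.symm (hlt q' q k' k h (by omega) hz'.2 hz.2)
  have hcard := Finset.card_le_card_of_injOn (s := Finset.range (Q + 1) ×ˢ S)
    (t := Finset.range (n + Q * s)) (fun z => z.2 + z.1 * s) (fun z hz => ?_) hinj
  · simpa using hcard
  · simp only [Finset.coe_product, mem_prod, Finset.mem_coe, Finset.mem_range] at hz ⊢
    have h1 := Finset.mem_range.1 (Finset.mem_filter.1 hz.2).1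
    have h2 : z.1 * s ≤ Q * s := Nat.mul_le_mul_right s (by omega)
    omega

variable {E : Type*} [MeasurableSpace E]

/-- This is the expectation of a bound valid for every path, so neither stationarity nor the Markov
property enters. -/
lemma sum_measure_visit_without_return_le (m : Measure (ℕ → E)) [IsProbabilityMeasure m]
    {U : Set E} (hU : MeasurableSet U) (Q s n : ℕ) :
    ∑ k ∈ Finset.range n, m {ω | ω k ∈ U ∧ ∀ q ∈ Finset.Icc 1 Q, ω (k + q * s) ∉ U} ≤
      ((Q : ℝ≥0∞) + 1)⁻¹ * n + Q * s := by
  classical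
  have hm : ∀ k, MeasurableSet {ω : ℕ → E | ω k ∈ U ∧ ∀ q ∈ Finset.Icc 1 Q, ω (k + q * s) ∉ U} := by
    intro k
    refine (hU.preimage (measurable_pi_apply k)).inter ?_
    have : {ω : ℕ → E | ∀ q ∈ Finset.Icc 1 Q, ω (k + q * s) ∉ U} =
        ⋂ q ∈ Finset.Icc 1 Q, {ω | ω (k + q * s) ∉ U} := by
      ext ω
      simp only [mem_iInter, mem_ofPred_eq]
    change MeasurableSet {ω : ℕ → E | ∀ q ∈ Finset.Icc 1 Q, ω (k + q * s) ∉ U}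
    rw [this]
    exact Finset.measurableSet_biInter _ fun q _ =>
      (hU.preimage (measurable_pi_apply (k + q * s))).compl
  calc ∑ k ∈ Finset.range n, m {ω | ω k ∈ U ∧ ∀ q ∈ Finset.Icc 1 Q, ω (k + q * s) ∉ U}
      = ∫⁻ ω, ∑ k ∈ Finset.range n,
          {ω : ℕ → E | ω k ∈ U ∧ ∀ q ∈ Finset.Icc 1 Q, ω (k + q * s) ∉ U}.indicator 1 ω ∂m := by
        rw [lintegral_finsetSum _ fun k _ => measurable_one.indicator (hm k)]
        simp only [lintegral_indicator_one (hm _)]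
    _ ≤ ∫⁻ _, (((Q : ℝ≥0∞) + 1)⁻¹ * (n + Q * s)) ∂m := by
        refine lintegral_mono fun ω => ?_
        have h1 := card_visit_without_return_le (fun k => ω k ∈ U) Q s n
        have h2 : ∑ k ∈ Finset.range n,
            {ω : ℕ → E | ω k ∈ U ∧ ∀ q ∈ Finset.Icc 1 Q, ω (k + q * s) ∉ U}.indicator
              (1 : (ℕ → E) → ℝ≥0∞) ω =
            ({k ∈ Finset.range n | ω k ∈ U ∧ ∀ q ∈ Finset.Icc 1 Q, ω (k + q * s) ∉ U}.card :
              ℝ≥0∞) := by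
          rw [Finset.card_filter]
          push_cast
          refine Finset.sum_congr rfl fun k _ => ?_
          simp [indicator_apply]
        rw [h2, ← ENNReal.div_eq_inv_mul, ENNReal.le_div_iff_mul_le (by simp) (by simp), mul_comm]
        exact_mod_cast h1
    _ = ((Q : ℝ≥0∞) + 1)⁻¹ * n + ((Q : ℝ≥0∞) + 1)⁻¹ * (Q * s) := by
        rw [lintegral_const, measure_univ, mul_one, mul_add]
    _ ≤ _ := by
        refine add_le_add le_rfl ?_
        exact mul_le_of_le_one_left' (ENNReal.inv_le_one.2 le_add_self)

end Counting

/-! ### Occupation of the region far from the Birkhoff center -/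

section Occupation

/-- Markov's inequality for `ψ` is combined with the cumulated drift inequality. Since `β γ ≤ C * α
γ`, the factor `α γ` cancels in the term linear in `n`, whose rate is thus uniform in `γ`. -/
lemma sum_measure_notMem_le {E : Type*} [NormedAddCommGroup E] [MeasurableSpace E] {γ₀ : ℝ}
    {P : Ioo (0 : ℝ) γ₀ → Kernel E E} [∀ γ, IsMarkovKernel (P γ)] {V ψ : E → ℝ}
    {α β : Ioo (0 : ℝ) γ₀ → ℝ} (hPH : PH P V ψ α β) {C Λ : ℝ} (hC : ∀ γ, β γ / α γ ≤ C)
    (hΛ : 0 < Λ) {K : Set E} (hK : ∀ x ∉ K, Λ ≤ ψ x) (γ : Ioo (0 : ℝ) γ₀) (ν : Measure E)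
    [IsProbabilityMeasure ν] (n : ℕ) :
    ∑ k ∈ Finset.range n, chainLaw ν (P γ) {ω | ω k ∉ K} ≤
      ENNReal.ofReal (C / Λ) * n +
        (ENNReal.ofReal (α γ * Λ))⁻¹ * ∫⁻ x, ENNReal.ofReal (V x) ∂ν := by
  have hα := hPH.alpha_pos γ
  have ha0 : ENNReal.ofReal (α γ * Λ) ≠ 0 := by simpa using mul_pos hα hΛ
  have ha1 : ENNReal.ofReal (α γ * Λ) ≠ ⊤ := ENNReal.ofReal_ne_top
  have hmarkov : ∀ k, ENNReal.ofReal Λ * chainLaw ν (P γ) {ω | ω k ∉ K} ≤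
      ∫⁻ ω, ENNReal.ofReal (ψ (ω k)) ∂(chainLaw ν (P γ)) := by
    intro k
    have hψ : Measurable fun ω : ℕ → E => ENNReal.ofReal (ψ (ω k)) :=
      hPH.measurable_psi.ennreal_ofReal.comp (measurable_pi_apply k)
    refine le_trans ?_ (mul_meas_ge_le_lintegral hψ (ENNReal.ofReal Λ))
    gcongr with ω
    intro hω
    exact ENNReal.ofReal_le_ofReal (hK _ hω)
  have hβ : ENNReal.ofReal (β γ) ≤ ENNReal.ofReal (α γ * Λ) * ENNReal.ofReal (C / Λ) := by
    rw [← ENNReal.ofReal_mul (by positivity)]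
    refine ENNReal.ofReal_le_ofReal ?_
    have := hC γ
    rw [div_le_iff₀ hα] at this
    refine this.trans_eq ?_
    field_simp
  have hsum := (le_add_self).trans (sum_lintegral_psi_le (ν := ν) hPH γ n)
  set S := ∑ k ∈ Finset.range n, chainLaw ν (P γ) {ω | ω k ∉ K}
  have h1 : ENNReal.ofReal (α γ * Λ) * S ≤ ∫⁻ x, ENNReal.ofReal (V x) ∂ν +
      n * (ENNReal.ofReal (α γ * Λ) * ENNReal.ofReal (C / Λ)) := by
    calc ENNReal.ofReal (α γ * Λ) * S = ENNReal.ofReal (α γ) *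
          ∑ k ∈ Finset.range n, ENNReal.ofReal Λ * chainLaw ν (P γ) {ω | ω k ∉ K} := by
          rw [← Finset.mul_sum, ENNReal.ofReal_mul hα.le, mul_assoc]
      _ ≤ ENNReal.ofReal (α γ) * ∑ k ∈ Finset.range n,
            ∫⁻ ω, ENNReal.ofReal (ψ (ω k)) ∂(chainLaw ν (P γ)) := by
          gcongr with k _
          exact hmarkov k
      _ ≤ _ := hsum
      _ ≤ _ := by gcongr
  generalize ENNReal.ofReal (α γ * Λ) = a at *
  calc S = a⁻¹ * (a * S) := by rw [← mul_assoc, ENNReal.inv_mul_cancel ha0 ha1, one_mul]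
    _ ≤ a⁻¹ * (∫⁻ x, ENNReal.ofReal (V x) ∂ν + n * (a * ENNReal.ofReal (C / Λ))) := by gcongr
    _ = (a⁻¹ * a) * (ENNReal.ofReal (C / Λ) * n) + a⁻¹ * ∫⁻ x, ENNReal.ofReal (V x) ∂ν := by ring
    _ = _ := by rw [ENNReal.inv_mul_cancel ha0 ha1, one_mul]

variable {Ξ E : Type*} [MeasurableSpace Ξ] [NormedAddCommGroup E] [InnerProductSpace ℝ E]
  [FiniteDimensional ℝ E] [MeasurableSpace E] [BorelSpace E] {μ : Measure Ξ}
  [IsProbabilityMeasure μ] {γ₀ : ℝ} {P : Ioo (0 : ℝ) γ₀ → Kernel E E} [∀ γ, IsMarkovKernel (P γ)]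
  {h : Ioo (0 : ℝ) γ₀ → Ξ → E → E} {H : Ξ → E → Set E} {V ψ : E → ℝ}
  {α β : Ioo (0 : ℝ) γ₀ → ℝ}

/-- For small step sizes, the expected number of visits far from the Birkhoff center is at most a
small multiple of the elapsed time, up to a constant. -/
theorem exists_sum_measure_far_le (hRM : RM P μ h H) (hPH : PH P V ψ α β) {ν : Measure E}
    [IsProbabilityMeasure ν] (hν : Integrable V ν) {ε : ℝ≥0∞} (hε : 0 < ε) {δ : ℝ} (hδ : 0 < δ) :
    ∃ γ₁ : ℝ, 0 < γ₁ ∧ ∀ γ : Ioo (0 : ℝ) γ₀, (γ : ℝ) < γ₁ → ∃ B : ℝ≥0∞, B ≠ ⊤ ∧ ∀ n : ℕ,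
      ∑ k ∈ Finset.range n, chainLaw ν (P γ) {ω | ε ≤ Metric.infEDist (ω k)
        (birkhoffCenter (evolution (meanMap μ H)))} ≤ 3 * ENNReal.ofReal δ * n + B := by
  classical
  have : ProperSpace E := FiniteDimensional.proper ℝ E
  obtain ⟨C, hC⟩ := hPH.ratio_bounded
  -- This gives `C / Λ ≤ δ`; adding `1` to `|C|` keeps `Λ` positive when `C = 0`.
  set Λ := (|C| + 1) / δ
  have hΛ : 0 < Λ := by positivity
  have hCΛ : C / Λ ≤ δ := by
    rw [div_le_iff₀ hΛ, mul_div_cancel₀ _ hδ.ne']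
    linarith [le_abs_self C]
  obtain ⟨RK, -, hRK⟩ := (hasBasis_cobounded_norm (E := E)).eventually_iff.1
    (hPH.psi_tendsto.eventually_ge_atTop Λ)
  set K := Metric.closedBall (0 : E) RK
  have hK : IsCompact K := isCompact_closedBall _ _
  have hKψ : ∀ x ∉ K, Λ ≤ ψ x := fun x hx => hRK (by
    simp only [K, mem_closedBall_zero_iff, not_le] at hx
    exact hx.le)
  set r : ℕ → ℝ := fun i => 1 / ((i : ℝ) + 1)
  have hr0 : ∀ i, 0 < r i := fun i => by positivity
  have hcover : ∀ i, ∃ t : Finset E, K ⊆ ⋃ c ∈ t, Metric.ball c (r i / 2) := by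
    intro i
    obtain ⟨t, ht1, ht2, ht3⟩ := hK.finite_cover_balls (half_pos (hr0 i))
    exact ⟨ht2.toFinset, by simpa using ht3⟩
  choose t ht using hcover
  -- The number `J` of scales is chosen later and depends on `Q`, so the errors must be summable
  -- over all scales.
  have hQex : ∀ i, ∃ Q : ℕ, (t i).card * ((Q : ℝ≥0∞) + 1)⁻¹ ≤ ENNReal.ofReal (δ / 2 ^ (i + 1)) := by
    intro i
    obtain ⟨Q, hQ⟩ := exists_nat_ge ((t i).card / (δ / 2 ^ (i + 1)))
    refine ⟨Q, ?_⟩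
    rw [← div_eq_mul_inv]
    refine ENNReal.div_le_of_le_mul ?_
    rw [← Nat.cast_add_one, ← ENNReal.ofReal_natCast, ← ENNReal.ofReal_natCast,
      ← ENNReal.ofReal_mul (by positivity)]
    refine ENNReal.ofReal_le_ofReal ?_
    rw [div_le_iff₀ (by positivity)] at hQ
    push_cast
    have : 0 < δ / 2 ^ (i + 1) := by positivity
    nlinarith
  choose Q hQ using hQex
  choose R ρ hρ hR using fun i : ℕ =>
    exists_radius_of_noiseSmall hRM hK (by positivity : (0 : ℝ) < i + 1)
  obtain ⟨J, hJ⟩ := exists_infEDist_birkhoffCenter_lt hRM hK hρ hR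
    (tendsto_one_div_add_atTop_nhds_zero_nat : Tendsto r atTop (𝓝 0)) Q hε
  choose g hg0 hg using fun i : ℕ => exists_measure_not_noiseSmall_le hRM (R i)
    (by positivity : (0 : ℝ) < i + 1) (by positivity : (0 : ℝ) < 1 / ((J : ℝ) + 1))
    (by positivity : 0 < δ / ((J : ℝ) + 1))
  refine ⟨min (1 / ((J : ℝ) + 1)) ((Finset.range (J + 1)).inf' (by simp) g), ?_, ?_⟩
  · refine lt_min (by positivity) ?_
    rw [Finset.lt_inf'_iff]
    exact fun i _ => hg0 i
  intro γ hγ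
  rw [lt_min_iff, Finset.lt_inf'_iff] at hγ
  obtain ⟨hγJ, hγg⟩ := hγ
  set s : ℕ → ℕ := fun i => (i + 1) * ⌈1 / (γ : ℝ)⌉₊
  set m := chainLaw ν (P γ)
  refine ⟨(ENNReal.ofReal (α γ * Λ))⁻¹ * ∫⁻ x, ENNReal.ofReal (V x) ∂ν +
    ∑ i ∈ Finset.range (J + 1), ∑ c ∈ t i, (Q i * s i : ℝ≥0∞), ?_, fun n => ?_⟩
  · refine ENNReal.add_ne_top.2 ⟨ENNReal.mul_ne_top ?_ ?_, ?_⟩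
    · have := mul_pos (hPH.alpha_pos γ) hΛ
      simpa using this
    · exact ((hasFiniteIntegral_iff_ofReal (ae_of_all _ hPH.V_nonneg)).1 hν.2).ne
    · exact ENNReal.sum_ne_top.2 fun i _ => ENNReal.sum_ne_top.2 fun c _ =>
        ENNReal.mul_ne_top (by simp) (by simp)
  -- If `ω k` lies in `K`, returns at every scale `i ≤ J` and is followed by small noise, it is
  -- close to the center. Each of the three ways to fail costs a rate of `δ`, whence the factor `3`.
  have hpoint : ∀ k, m {ω | ε ≤ Metric.infEDist (ω k) (birkhoffCenter (evolution (meanMap μ H)))} ≤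
      m {ω | ω k ∉ K} + ∑ i ∈ Finset.range (J + 1), ∑ c ∈ t i,
        m {ω | ω k ∈ Metric.ball c (r i / 2) ∧
          ∀ q ∈ Finset.Icc 1 (Q i), ω (k + q * s i) ∉ Metric.ball c (r i / 2)} +
      ∑ i ∈ Finset.range (J + 1), ENNReal.ofReal (δ / ((J : ℝ) + 1)) := by
    intro k
    have hsub : {ω : ℕ → E | ε ≤ Metric.infEDist (ω k)
          (birkhoffCenter (evolution (meanMap μ H)))} ⊆
        ({ω | ω k ∉ K} ∪ ⋃ i ∈ Finset.range (J + 1), ⋃ c ∈ t i,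
          {ω | ω k ∈ Metric.ball c (r i / 2) ∧
            ∀ q ∈ Finset.Icc 1 (Q i), ω (k + q * s i) ∉ Metric.ball c (r i / 2)}) ∪
        ⋃ i ∈ Finset.range (J + 1), {ω | ¬ NoiseSmall (meanField μ h γ) γ (R i) (i + 1)
          (1 / ((J : ℝ) + 1)) fun l => ω (k + l)} := by
      intro ω hω
      by_contra hno
      simp only [mem_union, mem_iUnion, mem_ofPred_eq, not_or, not_exists, not_not,
        Finset.mem_range, exists_prop, not_and, not_forall] at hno
      obtain ⟨⟨hωK, hret⟩, hnoise⟩ := hno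
      refine absurd (hJ γ hγJ (fun l => ω (k + l)) hωK
        (fun i hi => hnoise i (Nat.lt_succ_of_le hi)) fun i hi => ?_) (not_lt.2 hω)
      obtain ⟨c, hc, hkc⟩ := mem_iUnion₂.1 (ht i hωK)
      obtain ⟨q, hq, hqc⟩ := hret i (Nat.lt_succ_of_le hi) c hc hkc
      refine ⟨q, by simpa using hq, ?_⟩
      have h1 := Metric.mem_ball.1 hkc
      have h2 := Metric.mem_ball.1 hqc
      have h3 := dist_triangle_right (ω (k + q * s i)) (ω k) c
      show dist (ω (k + q * s i)) (ω k) ≤ r i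
      linarith
    refine (measure_mono hsub).trans ((measure_union_le _ _).trans (add_le_add
      ((measure_union_le _ _).trans (add_le_add le_rfl ?_)) ?_))
    · refine (measure_biUnion_finset_le _ _).trans (Finset.sum_le_sum fun i _ => ?_)
      exact measure_biUnion_finset_le _ _
    · refine (measure_biUnion_finset_le _ _).trans (Finset.sum_le_sum fun i hi => ?_)
      exact hg i γ (hγg i hi) ν k
  have hδJ : ∑ i ∈ Finset.range (J + 1), ENNReal.ofReal (δ / ((J : ℝ) + 1)) =
      ENNReal.ofReal δ := by
    rw [← ENNReal.ofReal_sum_of_nonneg fun _ _ => by positivity]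
    congr 1
    rw [Finset.sum_const, Finset.card_range, nsmul_eq_mul]
    push_cast
    field_simp
  have hgeom : ∑ i ∈ Finset.range (J + 1), ENNReal.ofReal (δ / 2 ^ (i + 1)) ≤
      ENNReal.ofReal δ := by
    rw [← ENNReal.ofReal_sum_of_nonneg fun _ _ => by positivity]
    refine ENNReal.ofReal_le_ofReal ?_
    have hind : ∀ j : ℕ, ∑ i ∈ Finset.range j, δ / 2 ^ (i + 1) = δ - δ / 2 ^ j := by
      intro j
      induction j with
      | zero => simp
      | succ j ih => rw [Finset.sum_range_succ, ih, pow_succ]; field_simp; ring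
    rw [hind]
    have : 0 < δ / 2 ^ (J + 1) := by positivity
    linarith
  have hmid : ∑ k ∈ Finset.range n, ∑ i ∈ Finset.range (J + 1), ∑ c ∈ t i,
        m {ω | ω k ∈ Metric.ball c (r i / 2) ∧
          ∀ q ∈ Finset.Icc 1 (Q i), ω (k + q * s i) ∉ Metric.ball c (r i / 2)} ≤
      ENNReal.ofReal δ * n + ∑ i ∈ Finset.range (J + 1), ∑ c ∈ t i, (Q i * s i : ℝ≥0∞) := by
    rw [Finset.sum_comm]
    calc _ ≤ ∑ i ∈ Finset.range (J + 1), (ENNReal.ofReal (δ / 2 ^ (i + 1)) * n +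
          ∑ c ∈ t i, (Q i * s i : ℝ≥0∞)) := by
          refine Finset.sum_le_sum fun i _ => ?_
          rw [Finset.sum_comm]
          calc _ ≤ ∑ c ∈ t i, (((Q i : ℝ≥0∞) + 1)⁻¹ * n + Q i * s i) :=
                Finset.sum_le_sum fun c _ => sum_measure_visit_without_return_le m
                  Metric.isOpen_ball.measurableSet (Q i) (s i) n
            _ = (t i).card * ((Q i : ℝ≥0∞) + 1)⁻¹ * n + ∑ c ∈ t i, (Q i * s i : ℝ≥0∞) := by
                rw [Finset.sum_add_distrib, Finset.sum_const, nsmul_eq_mul, mul_assoc]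
            _ ≤ _ := by gcongr; exact hQ i
      _ = (∑ i ∈ Finset.range (J + 1), ENNReal.ofReal (δ / 2 ^ (i + 1))) * n +
          ∑ i ∈ Finset.range (J + 1), ∑ c ∈ t i, (Q i * s i : ℝ≥0∞) := by
          rw [Finset.sum_add_distrib, Finset.sum_mul]
      _ ≤ _ := by gcongr
  calc _ ≤ ∑ k ∈ Finset.range n, _ := Finset.sum_le_sum fun k _ => hpoint k
    _ = ∑ k ∈ Finset.range n, m {ω | ω k ∉ K} + _ + n * ENNReal.ofReal δ := by
        rw [Finset.sum_add_distrib, Finset.sum_add_distrib, hδJ, Finset.sum_const,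
          Finset.card_range, nsmul_eq_mul]
    _ ≤ (ENNReal.ofReal δ * n + (ENNReal.ofReal (α γ * Λ))⁻¹ * ∫⁻ x, ENNReal.ofReal (V x) ∂ν) +
        (ENNReal.ofReal δ * n + ∑ i ∈ Finset.range (J + 1), ∑ c ∈ t i, (Q i * s i : ℝ≥0∞)) +
        n * ENNReal.ofReal δ := by
        gcongr
        refine (sum_measure_notMem_le hPH hC hΛ hKψ γ ν n).trans ?_
        gcongr
    _ = _ := by ring

end Occupation

end SADI

/-! ### The limit theorem -/

theorem mainTheorem1 (N : ℕ) (hN : 1 ≤ N) {Ξ : Type*} [MeasurableSpace Ξ] (μ : Measure Ξ)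
    [IsProbabilityMeasure μ] (γ₀ : ℝ) (hγ₀ : 0 < γ₀)
    (P : Ioo (0 : ℝ) γ₀ → Kernel (EuclideanSpace ℝ (Fin N)) (EuclideanSpace ℝ (Fin N)))
    [∀ γ, IsMarkovKernel (P γ)]
    (h : Ioo (0 : ℝ) γ₀ → Ξ → EuclideanSpace ℝ (Fin N) → EuclideanSpace ℝ (Fin N))
    (H : Ξ → EuclideanSpace ℝ (Fin N) → Set (EuclideanSpace ℝ (Fin N)))
    (V ψ : EuclideanSpace ℝ (Fin N) → ℝ) (α β : Ioo (0 : ℝ) γ₀ → ℝ)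
    (hRM : SADI.RM P μ h H) (hPH : SADI.PH P V ψ α β) (hFL : SADI.FL h)
    (hclosed : IsClosed (SADI.evolutionRange (SADI.evolution (SADI.meanMap μ H))))
    (ν : Measure (EuclideanSpace ℝ (Fin N))) [IsProbabilityMeasure ν] (hν : Integrable V ν)
    (ε : ℝ) (hε : 0 < ε) :
    Tendsto
      (fun γ : Ioo (0 : ℝ) γ₀ =>
        limsup
          (fun n : ℕ => ((n : ℝ≥0∞) + 1)⁻¹ * ∑ k ∈ Finset.range (n + 1),
            SADI.chainLaw ν (P γ)
              {ω | ENNReal.ofReal ε ≤ Metric.infEDist (ω k)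
                (SADI.birkhoffCenter (SADI.evolution (SADI.meanMap μ H)))})
          atTop)
      (comap Subtype.val (𝓝 (0 : ℝ))) (𝓝 0) := by
  rw [ENNReal.tendsto_nhds_zero]
  intro δ hδ
  obtain ⟨d, hd0, hd⟩ : ∃ d : ℝ, 0 < d ∧ 3 * ENNReal.ofReal d ≤ δ := by
    have hlim : Tendsto (fun d : ℝ => 3 * ENNReal.ofReal d) (𝓝[>] 0) (𝓝 (3 * ENNReal.ofReal 0)) :=
      (ENNReal.Tendsto.const_mul (ENNReal.tendsto_ofReal tendsto_id)
        (Or.inr (by simp))).mono_left nhdsWithin_le_nhds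
    rw [ENNReal.ofReal_zero, mul_zero] at hlim
    exact (eventually_mem_nhdsWithin.and (hlim.eventually_le_const hδ)).exists
  obtain ⟨γ₁, hγ₁, hmain⟩ := SADI.exists_sum_measure_far_le hRM hPH hν
    (ENNReal.ofReal_pos.2 hε) hd0
  have hev : ∀ᶠ γ : Ioo (0 : ℝ) γ₀ in comap Subtype.val (𝓝 (0 : ℝ)), (γ : ℝ) < γ₁ :=
    tendsto_comap.eventually_lt_const hγ₁
  filter_upwards [hev] with γ hγ
  obtain ⟨B, hB, hsum⟩ := hmain γ hγ
  have hinv : Tendsto (fun n : ℕ => ((n : ℝ≥0∞) + 1)⁻¹) atTop (𝓝 0) := by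
    have := ENNReal.tendsto_inv_nat_nhds_zero.comp (tendsto_add_atTop_nat 1)
    refine this.congr fun n => ?_
    simp
  -- The constant `B` may depend on `γ`, but it is finite and disappears in the average over `n`.
  have hlim : Tendsto (fun n : ℕ => 3 * ENNReal.ofReal d + ((n : ℝ≥0∞) + 1)⁻¹ * B) atTop
      (𝓝 (3 * ENNReal.ofReal d + 0 * B)) :=
    tendsto_const_nhds.add (ENNReal.Tendsto.mul_const hinv (Or.inr hB))
  rw [zero_mul, add_zero] at hlim
  refine le_trans (limsup_le_limsup (Eventually.of_forall fun n => ?_)) (hlim.limsup_eq.trans_le hd)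
  calc ((n : ℝ≥0∞) + 1)⁻¹ * _
      ≤ ((n : ℝ≥0∞) + 1)⁻¹ * (3 * ENNReal.ofReal d * (n + 1 : ℕ) + B) := by
        gcongr
        exact hsum (n + 1)
    _ = (((n : ℝ≥0∞) + 1)⁻¹ * (n + 1)) * (3 * ENNReal.ofReal d) + ((n : ℝ≥0∞) + 1)⁻¹ * B := by
        push_cast; ring
    _ = _ := by rw [ENNReal.inv_mul_cancel (by simp) (by simp), one_mul]
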